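/- Let $n\ge 1$. In the upper half-space model, $\mathbb H^{n+1}=\{z\in\mathbb R^{n+1}: z_{n+1}>0\}$ with $ds=|dz|/z_{n+1}$, boundary at infinity $\partial\mathbb H^{n+1}=\hat{\mathbb R}^n=\mathbb R^n\cup\{\infty\}$ and base point $O=\mathbf e_{n+1}$; in the conformal ball model, $\mathbb H^{n+1}=\{z\in\mathbb R^{n+1}:|z|<1\}$ with $ds=2|dz|/(1-|z|^2)$, boundary $\partial\mathbb H^{n+1}=\mathbb S^n$ and base point $O=\mathbf 0$. Let $dV$ be the hyperbolic volume element, let $d\omega$ be the spherical volume element on $\mathbb S^n$ (of total volume $2\pi^{(n+1)/2}/\Gamma(\tfrac{n+1}{2})$), and let $d\Omega=dV\,d\omega$ be the standard volume element on the unit tangent bundle $T_1\mathbb H^{n+1}$, where the hyperbolic unit sphere in each tangent space is identified with $\mathbb S^n$ by rescaling. The geodesic endpoint parametrization sends $v\in T_1\mathbb H^{n+1}$ to $(\xi_-,\xi_+,t)$, where $\xi_-,\xi_+\in\partial\mathbb H^{n+1}$ are the backward and forward endpoints of the complete geodesic directed by $v$, and $t\in\mathbb R$ is the signed hyperbolic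 distance along this geodesic from its closest point to $O$ to the base point of $v$. **Theorem 1.2.** (a) In the upper half-space model, the geodesic endpoint parametrization is a well-defined Borel isomorphism $$T_1\mathbb H^{n+1}\cong\{(\mathbf x,\mathbf y,t)\in\hat{\mathbb R}^n\times\hat{\mathbb R}^n\times\mathbb R:\mathbf x\ne\mathbf y\},$$ and in these coordinates $$d\Omega=\frac{2^n\,d\mathbf x\,d\mathbf y\,dt}{|\mathbf x-\mathbf y|^{2n}},$$ where $d\mathbf x$, $d\mathbf y$ are Lebesgue measure on $\mathbb R^n$ and the set of triples with $\mathbf x=\infty$ or $\mathbf y=\infty$ has measure zero. (b) In the conformal ball model, the geodesic endpoint parametrization is a well-defined Borel isomorphism $$T_1\mathbb H^{n+1}\cong\{(\mathbf p,\mathbf q,t)\in\mathbb S^n\times\mathbb S^n\times\mathbb R:\mathbf p\ne\mathbf q\},$$ and in these coordinates $$d\Omega=\frac{2^n\,d\omega(\mathbf p)\,d\omega(\mathbf q)\,dt}{|\mathbf p-\mathbf q|^{2n}}.$$ Both formulas for $d\Omega$ are equalities of measures (volume elements). -/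

import Mathlib

open MeasureTheory Filter Topology Metric

noncomputable section

namespace HypUT

/-- Euclidean space `ℝ^N`, with its standard norm and Lebesgue measure. -/
abbrev Euc (N : ℕ) : Type := EuclideanSpace ℝ (Fin N)

/-- The unit sphere of `ℝ^N`. -/
abbrev Sph (N : ℕ) : Type := sphere (0 : Euc N) 1

/-- The volume measure `dω` of the unit sphere of `ℝ^N` (polar coordinates: `dx = r^(N-1) dr dω`). -/
def sphVol (N : ℕ) : Measure (Sph N) := (volume : Measure (Euc N)).toSphere

/-! ### A domain `D` of `ℝ^N` with the conformal metric `ds = lam(x) |dx|` -/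

section Conformal

variable {N : ℕ} (D : Set (Euc N)) (lam : Euc N → ℝ)

/-- The Riemannian distance: the infimum of the lengths `∫ lam(c) |c'|` of the `C¹` curves
`c : [0,1] → D` from `x` to `y`. -/
def confDist (x y : Euc N) : ℝ :=
  sInf {L : ℝ | ∃ c : ℝ → Euc N, ContDiff ℝ 1 c ∧ (∀ s ∈ Set.Icc (0 : ℝ) 1, c s ∈ D) ∧
    c 0 = x ∧ c 1 = y ∧ L = ∫ s in (0 : ℝ)..1, lam (c s) * ‖deriv c s‖}

/-- Complete geodesics parametrized by signed arc length: isometric embeddings of `ℝ` into `D`. -/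
def IsGeodesicLine (c : ℝ → Euc N) : Prop :=
  (∀ s, c s ∈ D) ∧ ∀ s t, confDist D lam (c s) (c t) = |s - t|

/-- The unit tangent bundle: pairs (base point, tangent vector of length one for the metric). -/
abbrev UnitTangent : Type :=
  {v : Euc N × Euc N // v.1 ∈ D ∧ lam v.1 * ‖v.2‖ = 1}

/-- The Riemannian volume measure `dV = lam(x)^N dx` on `D` (a measure on `ℝ^N`, zero off `D`). -/
def confVol : Measure (Euc N) :=
  (volume.restrict D).withDensity fun x => ENNReal.ofReal (lam x ^ N)

/-- The measure `dΩ = dV dω` on the unit tangent bundle. The unit sphere of the tangent space at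
`x` is identified with the Euclidean unit sphere by `ω ↦ lam(x)⁻¹ ω`. -/
def unitTangentVol : Measure (UnitTangent D lam) :=
  (((confVol D lam).prod (sphVol N)).map
    fun p : Euc N × Sph N => (p.1, (lam p.1)⁻¹ • (p.2 : Euc N))).comap Subtype.val

/-- `c` is the complete unit speed geodesic directed by the unit tangent vector `v`, with parameter
`0` at its closest point to `O` and parameter `t` at the base point of `v`. So `t` is the signed
distance along `c` from that closest point to the base point of `v`. -/
def IsGeodesicOf (O : Euc N) (v : UnitTangent D lam) (c : ℝ → Euc N) (t : ℝ) : Prop :=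
  IsGeodesicLine D lam c ∧ (∀ s, confDist D lam O (c 0) ≤ confDist D lam O (c s)) ∧
    c t = v.1.1 ∧ HasDerivAt c v.1.2 t

end Conformal

/-! ### The upper half-space model of `ℍ^(n+1)` -/

/-- The upper half-space `{x ∈ ℝ^(n+1) : x_(n+1) > 0}`. -/
def upper (n : ℕ) : Set (Euc (n + 1)) := {x | 0 < x (Fin.last n)}

/-- The metric is `ds = |dx| / x_(n+1)`. -/
def upperFactor (n : ℕ) (x : Euc (n + 1)) : ℝ := 1 / x (Fin.last n)

/-- The base point `e_(n+1)`. -/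
def upperBase (n : ℕ) : Euc (n + 1) := EuclideanSpace.single (Fin.last n) 1

/-- `T₁ℍ^(n+1)` in the upper half-space model. -/
abbrev UpperUT (n : ℕ) : Type := UnitTangent (upper n) (upperFactor n)

/-- The inclusion `ℝ^n → ℝ^(n+1)`, `x ↦ (x, 0)`. -/
def boundaryIncl (n : ℕ) (x : Euc n) : Euc (n + 1) :=
  WithLp.toLp 2 (Fin.snoc (α := fun _ => ℝ) (fun i => x i) 0)

/-- The boundary at infinity `ℝ^n ∪ {∞}` as a part of `ℝ^(n+1) ∪ {∞}`. -/
def boundaryInclHat (n : ℕ) : OnePoint (Euc n) → OnePoint (Euc (n + 1)) :=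
  OnePoint.map (boundaryIncl n)

instance borelOnePoint (n : ℕ) : MeasurableSpace (OnePoint (Euc n)) := borel _

/-- Triples `(x, y, t)` with `x ≠ y` in `ℝ^n ∪ {∞}` and `t` real. -/
abbrev UpperTriples (n : ℕ) : Type :=
  {p : OnePoint (Euc n) × OnePoint (Euc n) × ℝ // p.1 ≠ p.2.1}

/-- `(x, y, t)` are the geodesic endpoint coordinates of `v`: backward endpoint, forward endpoint,
signed distance of the base point from the reference point. -/
def IsUpperCoord (n : ℕ) (v : UpperUT n) (p : UpperTriples n) : Prop :=
  ∃ c : ℝ → Euc (n + 1), IsGeodesicOf (upper n) (upperFactor n) (upperBase n) v c p.1.2.2 ∧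
    Tendsto (fun s => (c s : OnePoint (Euc (n + 1)))) atBot (𝓝 (boundaryInclHat n p.1.1)) ∧
    Tendsto (fun s => (c s : OnePoint (Euc (n + 1)))) atTop (𝓝 (boundaryInclHat n p.1.2.1))

/-- The measure `2^n dx dy dt / |x - y|^(2n)`; the triples with `x = ∞` or `y = ∞` are null. -/
def upperTripleVol (n : ℕ) : Measure (UpperTriples n) :=
  (((volume : Measure (Euc n × Euc n × ℝ)).withDensity
      fun p => ENNReal.ofReal (2 ^ n / ‖p.1 - p.2.1‖ ^ (2 * n))).map
    fun p : Euc n × Euc n × ℝ =>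
      ((p.1 : OnePoint (Euc n)), (p.2.1 : OnePoint (Euc n)), p.2.2)).comap Subtype.val

/-! ### The conformal ball model of `ℍ^(n+1)` -/

/-- The metric on the open unit ball is `ds = 2 |dx| / (1 - |x|²)`. -/
def ballFactor (n : ℕ) (x : Euc (n + 1)) : ℝ := 2 / (1 - ‖x‖ ^ 2)

/-- `T₁ℍ^(n+1)` in the conformal ball model. -/
abbrev BallUT (n : ℕ) : Type := UnitTangent (ball (0 : Euc (n + 1)) 1) (ballFactor n)

/-- Triples `(p, q, t)` with `p ≠ q` in the unit sphere `𝕊^n` of `ℝ^(n+1)` and `t` real. -/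
abbrev BallTriples (n : ℕ) : Type :=
  {p : Sph (n + 1) × Sph (n + 1) × ℝ // p.1 ≠ p.2.1}

/-- `(p, q, t)` are the geodesic endpoint coordinates of `v`, for the base point `0`. -/
def IsBallCoord (n : ℕ) (v : BallUT n) (p : BallTriples n) : Prop :=
  ∃ c : ℝ → Euc (n + 1), IsGeodesicOf (ball (0 : Euc (n + 1)) 1) (ballFactor n) 0 v c p.1.2.2 ∧
    Tendsto c atBot (𝓝 (p.1.1 : Euc (n + 1))) ∧ Tendsto c atTop (𝓝 (p.1.2.1 : Euc (n + 1)))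

/-- The measure `2^n dω(p) dω(q) dt / |p - q|^(2n)`. -/
def ballTripleVol (n : ℕ) : Measure (BallTriples n) :=
  (((sphVol (n + 1)).prod ((sphVol (n + 1)).prod (volume : Measure ℝ))).withDensity
    fun p => ENNReal.ofReal
      (2 ^ n / ‖(p.1 : Euc (n + 1)) - (p.2.1 : Euc (n + 1))‖ ^ (2 * n))).comap Subtype.val

end HypUT

end

/-! The bijection is proved in the ball, the volume formula in the half-space, and an inversion
carries each to the other model.

Ball: a point `x` lifts to the hyperboloid vector `X = ((1+|x|²)/(1-|x|²), 2x/(1-|x|²))`, and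
`ballCosh` is the Minkowski product of two lifts. The geodesic from `p` to `q` is the combination of
the null vectors `(1,q)` and `(1,p)` with coefficients `e^s/|p-q|` and `e^{-s}/|p-q|`; projected
back to the ball this is `ballGeo`. Busemann functions show that these curves realize the infimum of
lengths, so `cosh` of the distance is `ballCosh` (`cosh_confDist_ball`). An isometric line is
determined by its position and velocity at one time (`eq_ballGeo_of_isGeodesicLine`). Hence
`ballTangent`, the inverse of the coordinate map, is a Borel bijection, and the Lusin–Souslin
theorem makes its inverse Borel (`exists_ballCoord`).

Half-space: write a direction as `stereo u`, the inverse stereographic projection from the upward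
pole. The geodesic leaving `(a,h)` in this direction ends at `q = a + h u`. For fixed `q`, the pair
`(u,h)` is a function of the endpoint difference `w = p - q` and of the arc length `s` from the top
of the semicircle. The Jacobian of this substitution, the hyperbolic density and the density of
`stereo` multiply to `2^n/|w|^{2n}`, without `s` (`endpoint_density`). Since `t` differs from `s` by
a constant on each geodesic, `map_upperParam` gives the formula for `dΩ`.

Transfer: `cayley`, the inversion of radius `√2` centred at `-e_{n+1}`, is conformal, so it
preserves distances, geodesics and `dΩ`. On the boundary it is a stereographic projection up to a
reflection, and its conformal factors cancel in `dx dy/|x-y|^{2n}` (`map_boundaryTriple`). Both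
volume formulas then follow from `measurePreserving_comap_map`, with almost every finite endpoint
triple as common parameter. -/

noncomputable section

namespace HypUT

/-! ### Explicit geodesics of the ball, by Minkowski geometry. -/

section BallGeometry

variable {E : Type*} [NormedAddCommGroup E] [InnerProductSpace ℝ E]

local notation "⟪" x ", " y "⟫" => inner ℝ x y

/-- The geodesic of the ball model from `p` to `q`, with parameter `0` at the point closest to the
origin. -/
def ballGeo (p q : E) (s : ℝ) : E :=
  (‖p - q‖ + (Real.exp s + Real.exp (-s)))⁻¹ • (Real.exp s • q + Real.exp (-s) • p)

/-- The velocity of `ballGeo p q`. -/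
def ballGeoVel (p q : E) (s : ℝ) : E :=
  ((‖p - q‖ + (Real.exp s + Real.exp (-s)))⁻¹) ^ 2 •
    ((‖p - q‖ * Real.exp s + 2) • q - (‖p - q‖ * Real.exp (-s) + 2) • p)

/-- The hyperbolic cosine of the hyperbolic distance in the ball model. -/
def ballCosh (x z : E) : ℝ := 1 + 2 * ‖x - z‖ ^ 2 / ((1 - ‖x‖ ^ 2) * (1 - ‖z‖ ^ 2))

lemma exp_mul_exp_neg (s : ℝ) : Real.exp s * Real.exp (-s) = 1 := by
  rw [← Real.exp_add]; simp

omit [InnerProductSpace ℝ E] in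
lemma ballGeo_denom_pos (p q : E) (s : ℝ) :
    0 < ‖p - q‖ + (Real.exp s + Real.exp (-s)) := by positivity

lemma inner_of_unit {p q : E} (hp : ‖p‖ = 1) (hq : ‖q‖ = 1) :
    ⟪p, q⟫ = 1 - ‖p - q‖ ^ 2 / 2 := by
  rw [norm_sub_sq_real, hp, hq]; ring

lemma norm_sq_comb (a b : ℝ) (p q : E) :
    ‖a • q + b • p‖ ^ 2 = a ^ 2 * ‖q‖ ^ 2 + 2 * a * b * ⟪p, q⟫ + b ^ 2 * ‖p‖ ^ 2 := by
  rw [norm_add_sq_real, norm_smul, norm_smul, inner_smul_left, inner_smul_right,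
    real_inner_comm, mul_pow, mul_pow, Real.norm_eq_abs, Real.norm_eq_abs, sq_abs, sq_abs]
  simp; ring

lemma one_sub_norm_ballGeo_sq {p q : E} (hp : ‖p‖ = 1) (hq : ‖q‖ = 1) (s : ℝ) :
    1 - ‖ballGeo p q s‖ ^ 2 = 2 * ‖p - q‖ / (‖p - q‖ + (Real.exp s + Real.exp (-s))) := by
  have hS := (ballGeo_denom_pos p q s).ne'
  have he := exp_mul_exp_neg s
  rw [ballGeo, norm_smul, mul_pow, norm_sq_comb, inner_of_unit hp hq, hp, hq, Real.norm_eq_abs,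
    sq_abs]
  set d := ‖p - q‖
  generalize Real.exp s = a at *
  generalize Real.exp (-s) = b at *
  field_simp
  linear_combination (2 - d ^ 2) * (-1) * he + 2 * he

lemma norm_ballGeo_lt {p q : E} (hp : ‖p‖ = 1) (hq : ‖q‖ = 1) (hpq : p ≠ q) (s : ℝ) :
    ‖ballGeo p q s‖ < 1 := by
  have h := one_sub_norm_ballGeo_sq hp hq s
  have hd : 0 < ‖p - q‖ := norm_pos_iff.2 (sub_ne_zero.2 hpq)
  have : 0 < 1 - ‖ballGeo p q s‖ ^ 2 := by rw [h]; positivity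
  nlinarith [norm_nonneg (ballGeo p q s)]

lemma hasDerivAt_ballGeo (p q : E) (s : ℝ) :
    HasDerivAt (ballGeo p q) (ballGeoVel p q s) s := by
  have hS := (ballGeo_denom_pos p q s).ne'
  have h1 : HasDerivAt (fun s : ℝ => Real.exp s) (Real.exp s) s := Real.hasDerivAt_exp s
  have h2 : HasDerivAt (fun s : ℝ => Real.exp (-s)) (-Real.exp (-s)) s := by
    simpa using (hasDerivAt_neg s).exp
  have h3 : HasDerivAt (fun s : ℝ => (‖p - q‖ + (Real.exp s + Real.exp (-s)))⁻¹)
      (-(Real.exp s + -Real.exp (-s)) / (‖p - q‖ + (Real.exp s + Real.exp (-s))) ^ 2) s :=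
    ((h1.add h2).const_add ‖p - q‖).fun_inv hS
  have h4 : HasDerivAt (fun s : ℝ => Real.exp s • q + Real.exp (-s) • p)
      (Real.exp s • q + (-Real.exp (-s)) • p) s := (h1.smul_const q).add (h2.smul_const p)
  refine (h3.smul h4).congr_deriv ?_
  have he := exp_mul_exp_neg s
  simp only [ballGeoVel]
  generalize Real.exp s = a at *
  generalize Real.exp (-s) = b at *
  set d := ‖p - q‖
  match_scalars
  · field_simp
    linear_combination 2 * he
  · field_simp
    linear_combination (-2) * he

lemma norm_ballGeoVel {p q : E} (hp : ‖p‖ = 1) (hq : ‖q‖ = 1) (s : ℝ) :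
    ‖ballGeoVel p q s‖ = ‖p - q‖ / (‖p - q‖ + (Real.exp s + Real.exp (-s))) := by
  have hS := (ballGeo_denom_pos p q s)
  have he := exp_mul_exp_neg s
  rw [← sq_eq_sq₀ (norm_nonneg _) (by positivity), ballGeoVel, norm_smul, mul_pow,
    show ∀ a b : ℝ, a • q - b • p = a • q + (-b) • p from fun a b => by
      rw [neg_smul, sub_eq_add_neg], norm_sq_comb, inner_of_unit hp hq, hp, hq, Real.norm_eq_abs, sq_abs]
  set d := ‖p - q‖
  generalize Real.exp s = a at *
  generalize Real.exp (-s) = b at *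
  field_simp
  linear_combination (d ^ 2 * (-4) + d ^ 4) * he

lemma unit_speed_ballGeo {p q : E} (hp : ‖p‖ = 1) (hq : ‖q‖ = 1) (hpq : p ≠ q) (s : ℝ) :
    2 / (1 - ‖ballGeo p q s‖ ^ 2) * ‖ballGeoVel p q s‖ = 1 := by
  have hS := (ballGeo_denom_pos p q s).ne'
  have hd : ‖p - q‖ ≠ 0 := norm_ne_zero_iff.2 (sub_ne_zero.2 hpq)
  rw [one_sub_norm_ballGeo_sq hp hq, norm_ballGeoVel hp hq]
  field_simp

lemma continuous_ballGeoVel (p q : E) : Continuous (ballGeoVel p q) := by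
  unfold ballGeoVel
  have : ∀ s : ℝ, ‖p - q‖ + (Real.exp s + Real.exp (-s)) ≠ 0 := fun s =>
    (ballGeo_denom_pos p q s).ne'
  fun_prop (disch := assumption)

lemma contDiff_ballGeo (p q : E) : ContDiff ℝ 1 (ballGeo p q) := by
  rw [contDiff_one_iff_deriv]
  refine ⟨fun s => (hasDerivAt_ballGeo p q s).differentiableAt, ?_⟩
  rw [funext fun s => (hasDerivAt_ballGeo p q s).deriv]
  exact continuous_ballGeoVel p q

/-- The Minkowski product of the lift of `z` with `(1,q)` is `|z-q|²/(1-|z|²)` for a unit vector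
`q`. The lift of the geodesic is linear in `e^s` and `e^{-s}`, hence so is its product with the lift
of `z`. -/
lemma ballCosh_ballGeo {p q z : E} (hp : ‖p‖ = 1) (hq : ‖q‖ = 1) (hpq : p ≠ q) (hz : ‖z‖ < 1)
    (s : ℝ) : ballCosh z (ballGeo p q s) =
      (Real.exp s * ‖z - q‖ ^ 2 + Real.exp (-s) * ‖z - p‖ ^ 2) / ((1 - ‖z‖ ^ 2) * ‖p - q‖) := by
  have hS := (ballGeo_denom_pos p q s).ne'
  have hd : ‖p - q‖ ≠ 0 := norm_ne_zero_iff.2 (sub_ne_zero.2 hpq)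
  have hm : 1 - ‖z‖ ^ 2 ≠ 0 := by nlinarith [norm_nonneg z]
  have h1 := one_sub_norm_ballGeo_sq hp hq s
  have h2 : ‖ballGeo p q s‖ ^ 2 = 1 - 2 * ‖p - q‖ / (‖p - q‖ + (Real.exp s + Real.exp (-s))) := by
    linarith
  rw [ballCosh, h1, norm_sub_sq_real, norm_sub_sq_real, norm_sub_sq_real, h2, hp, hq]
  rw [ballGeo, inner_smul_right, inner_add_right, inner_smul_right, inner_smul_right]
  generalize Real.exp s = a at *
  generalize Real.exp (-s) = b at *
  generalize ‖p - q‖ = d at *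
  generalize ⟪z, p⟫ = zp
  generalize ⟪z, q⟫ = zq
  field_simp
  ring

lemma ballCosh_ballGeo_ballGeo {p q : E} (hp : ‖p‖ = 1) (hq : ‖q‖ = 1) (hpq : p ≠ q)
    (s t : ℝ) : ballCosh (ballGeo p q s) (ballGeo p q t) = Real.cosh (s - t) := by
  have hS := (ballGeo_denom_pos p q s).ne'
  have hd : ‖p - q‖ ≠ 0 := norm_ne_zero_iff.2 (sub_ne_zero.2 hpq)
  have h1 := one_sub_norm_ballGeo_sq hp hq s
  have h2 : ‖ballGeo p q s‖ ^ 2 = 1 - 2 * ‖p - q‖ / (‖p - q‖ + (Real.exp s + Real.exp (-s))) := by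
    linarith
  have he := exp_mul_exp_neg s
  have hpp := real_inner_self_eq_norm_sq p
  have hqq := real_inner_self_eq_norm_sq q
  have hc := real_inner_comm p q
  rw [ballCosh_ballGeo hp hq hpq (norm_ballGeo_lt hp hq hpq s), h1, norm_sub_sq_real,
    norm_sub_sq_real, h2, hp, hq, ballGeo, real_inner_smul_left, real_inner_smul_left,
    inner_add_left, inner_add_left, real_inner_smul_left, real_inner_smul_left,
    real_inner_smul_left, real_inner_smul_left, hpp, hqq, hc, inner_of_unit hp hq, hp, hq,
    Real.cosh_eq, show -(s - t) = -s + t by ring, show s - t = s + -t by ring, Real.exp_add,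
    Real.exp_add]
  generalize Real.exp s = a at *
  generalize Real.exp (-s) = b at *
  generalize ‖p - q‖ = d at *
  field_simp
  ring

/-- A point of the ball together with a normalized null vector `(A, a)` of Minkowski space lies on
the geodesic with forward endpoint `a⁻¹ A`. -/
lemma exists_ballGeo_of_null {x A : E} {a : ℝ} (hx : ‖x‖ < 1) (hA : ‖A‖ ^ 2 = a ^ 2)
    (hxA : (1 + ‖x‖ ^ 2) * a - 2 * ⟪x, A⟫ = 1 - ‖x‖ ^ 2) :
    ∃ p q : E, ∃ t : ℝ, ‖p‖ = 1 ∧ ‖q‖ = 1 ∧ p ≠ q ∧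
      Real.exp t = ‖p - q‖ / 2 * a ∧
      Real.exp (-t) = ‖p - q‖ / 2 * (2 * (1 + ‖x‖ ^ 2) / (1 - ‖x‖ ^ 2) - a) ∧
      Real.exp t • q = (‖p - q‖ / 2) • A ∧
      Real.exp (-t) • p = (‖p - q‖ / 2) • ((4 / (1 - ‖x‖ ^ 2)) • x - A) := by
  have hx0 := norm_nonneg x
  have hm : 0 < 1 - ‖x‖ ^ 2 := by nlinarith
  have hcs := abs_le.1 (abs_real_inner_le_norm x A)
  have hAa : ‖A‖ = |a| := by
    rw [← abs_of_nonneg (norm_nonneg A)]; exact sq_eq_sq_iff_abs_eq_abs _ _ |>.1 hA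
  have ha : 0 < a := by
    by_contra! h
    rw [abs_of_nonpos h] at hAa
    rw [hAa] at hcs
    nlinarith [sq_nonneg (1 - ‖x‖), mul_nonneg (sq_nonneg (1 - ‖x‖)) (neg_nonneg.2 h)]
  rw [abs_of_pos ha] at hAa
  rw [hAa] at hcs
  -- `(b, B) = 2X - (a, A)`, so that `X` is the midpoint of `(a, A)` and `(b, B)`. It is null
  -- because `X` has square one and product one with `(a, A)`. Rescaling both null vectors to time
  -- component one gives the endpoints.
  set b : ℝ := 2 * (1 + ‖x‖ ^ 2) / (1 - ‖x‖ ^ 2) - a with hb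
  set B : E := (4 / (1 - ‖x‖ ^ 2)) • x - A with hB
  have hbm : b * (1 - ‖x‖ ^ 2) = 2 * (1 + ‖x‖ ^ 2) - a * (1 - ‖x‖ ^ 2) := by
    rw [hb]; field_simp
  have hb0 : 0 < b := by
    have h1 : (1 - ‖x‖) ^ 2 * a ≤ 1 - ‖x‖ ^ 2 := by nlinarith
    have h2 : (1 - ‖x‖) * a ≤ 1 + ‖x‖ := by
      by_contra! h
      nlinarith
    have : 0 < b * (1 - ‖x‖ ^ 2) := by
      rw [hbm]; nlinarith [pow_pos (sub_pos.2 hx) 2]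
    exact pos_of_mul_pos_left this hm.le
  have hxA' : ⟪x, A⟫ = ((1 + ‖x‖ ^ 2) * a - (1 - ‖x‖ ^ 2)) / 2 := by linarith
  have hBn : ‖B‖ ^ 2 = b ^ 2 := by
    rw [hB, hb, norm_sub_sq_real, norm_smul, real_inner_smul_left, hxA', hAa, mul_pow,
      Real.norm_eq_abs, sq_abs]
    field_simp
    ring
  have hBb : ‖B‖ = b := by
    rwa [sq_eq_sq₀ (norm_nonneg _) hb0.le] at hBn
  have hAB : ⟪B, A⟫ = a * b - 2 := by
    rw [hB, hb, inner_sub_left, real_inner_smul_left, hxA', real_inner_self_eq_norm_sq, hAa]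
    field_simp
    ring
  have hd2 : ‖b⁻¹ • B - a⁻¹ • A‖ ^ 2 = 4 / (a * b) := by
    rw [norm_sub_sq_real, norm_smul, norm_smul, real_inner_smul_left, real_inner_smul_right, hAB,
      hBb, hAa, norm_inv, norm_inv, Real.norm_eq_abs, Real.norm_eq_abs, abs_of_pos ha,
      abs_of_pos hb0]
    field_simp
    ring
  set d := ‖b⁻¹ • B - a⁻¹ • A‖ with hd
  have hd0 : 0 < d := by
    have : 0 < d ^ 2 := by rw [hd2]; positivity
    exact lt_of_le_of_ne (norm_nonneg _) fun h => by simp [← h] at this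
  have he : Real.exp (Real.log (d / 2 * a)) = d / 2 * a := Real.exp_log (by positivity)
  have he' : Real.exp (-Real.log (d / 2 * a)) = d / 2 * b := by
    rw [Real.exp_neg, he]
    field_simp
    rw [hd2]
    field_simp
    norm_num
  refine ⟨b⁻¹ • B, a⁻¹ • A, Real.log (d / 2 * a), ?_, ?_, ?_, he, he', ?_, ?_⟩
  · rw [norm_smul, hBb, norm_inv, Real.norm_eq_abs, abs_of_pos hb0, inv_mul_cancel₀ hb0.ne']
  · rw [norm_smul, hAa, norm_inv, Real.norm_eq_abs, abs_of_pos ha, inv_mul_cancel₀ ha.ne']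
  · intro h
    rw [hd, h, sub_self, norm_zero] at hd0
    exact hd0.false
  · rw [he, ← mul_smul, mul_assoc, mul_inv_cancel₀ ha.ne', mul_one]
  · rw [he', ← mul_smul, mul_assoc, mul_inv_cancel₀ hb0.ne', mul_one]

/-- In the lift, moving by arc length `r` from `(A+B)/2` leads to `(e^r A + e^{-r} B)/2`. The
hypothesis `hy` says that `y` is the ball projection of this vector, with denominators cleared. -/
lemma ballGeo_add_of_null {p q A B : E} {a b t : ℝ} (hpq : p ≠ q)
    (h1 : Real.exp t = ‖p - q‖ / 2 * a) (h2 : Real.exp (-t) = ‖p - q‖ / 2 * b)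
    (h3 : Real.exp t • q = (‖p - q‖ / 2) • A) (h4 : Real.exp (-t) • p = (‖p - q‖ / 2) • B)
    {r : ℝ} {y : E}
    (hy : (2 + (Real.exp r * a + Real.exp (-r) * b)) • y = Real.exp r • A + Real.exp (-r) • B) :
    ballGeo p q (t + r) = y := by
  have hd : ‖p - q‖ ≠ 0 := norm_ne_zero_iff.2 (sub_ne_zero.2 hpq)
  rw [ballGeo, inv_smul_eq_iff₀ (ballGeo_denom_pos p q (t + r)).ne', neg_add, Real.exp_add,
    Real.exp_add, mul_comm (Real.exp t), mul_comm (Real.exp (-t)), mul_smul, mul_smul, h3, h4, h1,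
    h2, smul_comm _ (‖p - q‖ / 2) A, smul_comm _ (‖p - q‖ / 2) B, ← smul_add, ← hy, ← mul_smul]
  congr 1
  ring

omit [InnerProductSpace ℝ E] in
lemma one_lt_ballCosh {x z : E} (hx : ‖x‖ < 1) (hz : ‖z‖ < 1) (hxz : x ≠ z) :
    1 < ballCosh x z := by
  have hd : 0 < ‖x - z‖ := norm_pos_iff.2 (sub_ne_zero.2 hxz)
  have h1 : 0 < 1 - ‖x‖ ^ 2 := by nlinarith [norm_nonneg x]
  have h2 : 0 < 1 - ‖z‖ ^ 2 := by nlinarith [norm_nonneg z]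
  have : 0 < 2 * ‖x - z‖ ^ 2 / ((1 - ‖x‖ ^ 2) * (1 - ‖z‖ ^ 2)) := by positivity
  rw [ballCosh]; linarith

lemma exists_ballGeo_through {x z : E} (hx : ‖x‖ < 1) (hz : ‖z‖ < 1) (hxz : x ≠ z) :
    ∃ p q : E, ∃ s t : ℝ, ‖p‖ = 1 ∧ ‖q‖ = 1 ∧ p ≠ q ∧ s < t ∧
      ballGeo p q s = x ∧ ballGeo p q t = z := by
  have hc := one_lt_ballCosh hx hz hxz
  have hmx : 0 < 1 - ‖x‖ ^ 2 := by nlinarith [norm_nonneg x]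
  have hmz : 0 < 1 - ‖z‖ ^ 2 := by nlinarith [norm_nonneg z]
  obtain ⟨r, hr, hrc⟩ : ∃ r : ℝ, 0 < r ∧ Real.cosh r = ballCosh x z :=
    ⟨Real.arcosh (ballCosh x z), Real.arcosh_pos hc, Real.cosh_arcosh hc.le⟩
  have hee := exp_mul_exp_neg r
  have hsh : 0 < Real.sinh r := Real.sinh_pos_iff.2 hr
  rw [Real.cosh_eq] at hrc
  rw [Real.sinh_eq] at hsh
  rw [ballCosh, norm_sub_sq_real] at hrc
  set f := Real.exp (-r)
  have hrf : 1 + f ^ 2 = 2 * f * (1 + 2 * (‖x‖ ^ 2 - 2 * ⟪x, z⟫ + ‖z‖ ^ 2) /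
      ((1 - ‖x‖ ^ 2) * (1 - ‖z‖ ^ 2))) := by
    rw [← hrc]; linear_combination -hee
  set g := (Real.exp r - f) / 2 with hg
  have hfg : 2 * f * g = 1 - f ^ 2 := by rw [hg]; linear_combination hee
  have hxz' : 4 * f * ⟪x, z⟫ = 2 * f * (‖x‖ ^ 2 + ‖z‖ ^ 2) -
      (1 + f ^ 2 - 2 * f) * ((1 - ‖x‖ ^ 2) * (1 - ‖z‖ ^ 2)) / 2 := by
    rw [hrf]; field_simp; ring
  have hf : 0 < f := Real.exp_pos _
  have hxz'' : ⟪x, z⟫ = (2 * f * (‖x‖ ^ 2 + ‖z‖ ^ 2) -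
      (1 + f ^ 2 - 2 * f) * ((1 - ‖x‖ ^ 2) * (1 - ‖z‖ ^ 2)) / 2) / (4 * f) := by
    rw [← hxz']; field_simp
  have hgv : g = (1 - f ^ 2) / (2 * f) := by rw [← hfg]; field_simp
  have h1f : 1 - f ^ 2 ≠ 0 := by rw [← hfg]; positivity
  -- From `X = (A+B)/2` and `Z = (e^r A + e^{-r} B)/2` follows `A = (Z - e^{-r} X)/sinh r`. Here `f
  -- = e^{-r}` and `g = sinh r`.
  obtain ⟨p, q, t, hp, hq, hpq, h1, h2, h3, h4⟩ := exists_ballGeo_of_null hx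
    (A := g⁻¹ • ((2 / (1 - ‖z‖ ^ 2)) • z - (f * (2 / (1 - ‖x‖ ^ 2))) • x))
    (a := g⁻¹ * ((1 + ‖z‖ ^ 2) / (1 - ‖z‖ ^ 2) - f * ((1 + ‖x‖ ^ 2) / (1 - ‖x‖ ^ 2))))
    (by
      rw [norm_smul, mul_pow, norm_sub_sq_real, norm_smul, norm_smul, real_inner_smul_left,
        real_inner_smul_right, mul_pow, mul_pow, Real.norm_eq_abs, Real.norm_eq_abs,
        Real.norm_eq_abs, sq_abs, sq_abs, sq_abs, real_inner_comm, hxz'',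
        mul_pow _ (_ - _ : ℝ)]
      congr 1
      field_simp
      ring)
    (by
      rw [real_inner_smul_right, inner_sub_right, real_inner_smul_right, real_inner_smul_right,
        real_inner_self_eq_norm_sq, hxz'', hgv]
      field_simp
      ring)
  refine ⟨p, q, t, t + r, hp, hq, hpq, by linarith, ?_, ?_⟩
  · rw [← add_zero t]
    refine ballGeo_add_of_null hpq h1 h2 h3 h4 ?_
    simp only [Real.exp_zero, neg_zero]
    match_scalars <;> field_simp <;> ring
  · refine ballGeo_add_of_null hpq h1 h2 h3 h4 ?_
    have e1 : Real.exp r = 2 * g + f := by rw [hg]; ring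
    have : g ≠ 0 := hsh.ne'
    rw [e1, show Real.exp (-r) = f from rfl]
    match_scalars <;> field_simp <;> ring

lemma exists_ballGeo_tangent {x v : E} (hx : ‖x‖ < 1) (hv : 2 / (1 - ‖x‖ ^ 2) * ‖v‖ = 1) :
    ∃ p q : E, ∃ t : ℝ, ‖p‖ = 1 ∧ ‖q‖ = 1 ∧ p ≠ q ∧
      ballGeo p q t = x ∧ ballGeoVel p q t = v := by
  have hm : 0 < 1 - ‖x‖ ^ 2 := by nlinarith [norm_nonneg x]
  have hv' : ‖v‖ = (1 - ‖x‖ ^ 2) / 2 := by field_simp at hv; linarith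
  -- The null vector is `X + V`, where `V` is the derivative of the lift at `x` applied to `v`.
  obtain ⟨p, q, t, hp, hq, hpq, h1, h2, h3, h4⟩ := exists_ballGeo_of_null hx
    (A := (2 / (1 - ‖x‖ ^ 2) + 4 * ⟪x, v⟫ / (1 - ‖x‖ ^ 2) ^ 2) • x + (2 / (1 - ‖x‖ ^ 2)) • v)
    (a := (1 + ‖x‖ ^ 2) / (1 - ‖x‖ ^ 2) + 4 * ⟪x, v⟫ / (1 - ‖x‖ ^ 2) ^ 2)
    (by
      rw [norm_sq_comb, hv', real_inner_comm]
      field_simp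
      ring)
    (by
      rw [inner_add_right, real_inner_smul_right, real_inner_smul_right,
        real_inner_self_eq_norm_sq]
      field_simp
      ring)
  have hd : ‖p - q‖ ≠ 0 := norm_ne_zero_iff.2 (sub_ne_zero.2 hpq)
  refine ⟨p, q, t, hp, hq, hpq, ?_, ?_⟩
  · rw [← add_zero t]
    refine ballGeo_add_of_null hpq h1 h2 h3 h4 ?_
    simp only [Real.exp_zero, neg_zero]
    match_scalars <;> field_simp <;> ring
  · have he := exp_mul_exp_neg t
    have e1 : (‖p - q‖ * Real.exp t + 2) • q = (‖p - q‖ + 2 * Real.exp (-t)) • Real.exp t • q := by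
      rw [← mul_smul]; congr 1; linear_combination -2 * he
    have e2 : (‖p - q‖ * Real.exp (-t) + 2) • p =
        (‖p - q‖ + 2 * Real.exp t) • Real.exp (-t) • p := by
      rw [← mul_smul]; congr 1; linear_combination -2 * he
    rw [ballGeoVel, e1, e2, inv_pow, inv_smul_eq_iff₀ (pow_ne_zero 2 (ballGeo_denom_pos p q t).ne'),
      h3, h4, h1, h2]
    match_scalars <;> field_simp <;> ring

end BallGeometry

/-! ### Bounds for the infimum of lengths. -/

section ConfDist

variable {N : ℕ} {D : Set (Euc N)} {lam : Euc N → ℝ}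

lemma confDist_nonneg (hlam : ∀ x ∈ D, 0 ≤ lam x) (x y : Euc N) : 0 ≤ confDist D lam x y := by
  refine Real.sInf_nonneg ?_
  rintro L ⟨c, -, hD, -, -, rfl⟩
  refine intervalIntegral.integral_nonneg zero_le_one fun s hs => ?_
  exact mul_nonneg (hlam _ (hD s hs)) (norm_nonneg _)

lemma confDist_le (hlam : ∀ x ∈ D, 0 ≤ lam x) {c : ℝ → Euc N} (hc : ContDiff ℝ 1 c)
    (hD : ∀ s ∈ Set.Icc (0 : ℝ) 1, c s ∈ D) :
    confDist D lam (c 0) (c 1) ≤ ∫ s in (0 : ℝ)..1, lam (c s) * ‖deriv c s‖ := by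
  refine csInf_le ⟨0, ?_⟩ ⟨c, hc, hD, rfl, rfl, rfl⟩
  rintro L ⟨c, -, hD, -, -, rfl⟩
  refine intervalIntegral.integral_nonneg zero_le_one fun s hs => ?_
  exact mul_nonneg (hlam _ (hD s hs)) (norm_nonneg _)

/-- Convexity supplies the segment as a competitor. Without any competitor the real `sInf` would be
`0` and the bound could fail. -/
lemma le_confDist (hconv : Convex ℝ D) {x y : Euc N} (hx : x ∈ D) (hy : y ∈ D) {d : ℝ}
    (h : ∀ c : ℝ → Euc N, ContDiff ℝ 1 c → (∀ s ∈ Set.Icc (0 : ℝ) 1, c s ∈ D) → c 0 = x →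
      c 1 = y → d ≤ ∫ s in (0 : ℝ)..1, lam (c s) * ‖deriv c s‖) :
    d ≤ confDist D lam x y := by
  refine le_csInf ⟨_, fun s : ℝ => x + s • (y - x), by fun_prop, fun s hs => ?_, by simp, by simp,
    rfl⟩ ?_
  · exact hconv.add_smul_sub_mem hx hy hs
  · rintro L ⟨c, hc, hD, h0, h1, rfl⟩
    exact h c hc hD h0 h1

end ConfDist

/-! ### The hyperbolic distance of the ball and its geodesic lines. -/

section BallDist

variable {n : ℕ}

local notation "⟪" x ", " y "⟫" => inner ℝ x y
local notation "𝔹" => ball (0 : Euc (n + 1)) 1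

lemma one_sub_norm_sq_pos {E : Type*} [NormedAddCommGroup E] {x : E} (hx : ‖x‖ < 1) :
    0 < 1 - ‖x‖ ^ 2 := by
  nlinarith [norm_nonneg x]

lemma ballFactor_nonneg : ∀ x ∈ 𝔹, 0 ≤ ballFactor n x := by
  intro x hx
  have := one_sub_norm_sq_pos (mem_ball_zero_iff.1 hx)
  rw [ballFactor]; positivity

lemma confDist_ballGeo_le {p q : Euc (n + 1)} (hp : ‖p‖ = 1) (hq : ‖q‖ = 1) (hpq : p ≠ q)
    (s t : ℝ) :
    confDist 𝔹 (ballFactor n) (ballGeo p q s) (ballGeo p q t) ≤ |s - t| := by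
  have hd : ∀ τ : ℝ, HasDerivAt (fun τ => ballGeo p q (s + τ * (t - s)))
      ((t - s) • ballGeoVel p q (s + τ * (t - s))) τ := fun τ => by
    have h1 : HasDerivAt (fun τ : ℝ => s + τ * (t - s)) (t - s) τ := by
      simpa using ((hasDerivAt_id τ).mul_const (t - s)).const_add s
    exact (hasDerivAt_ballGeo p q _).scomp τ h1
  have h := confDist_le ballFactor_nonneg (c := fun τ => ballGeo p q (s + τ * (t - s)))
    ((contDiff_ballGeo p q).comp (by fun_prop))
    fun τ _ => mem_ball_zero_iff.2 (norm_ballGeo_lt hp hq hpq _)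
  simp only [zero_mul, add_zero, one_mul, add_sub_cancel] at h
  refine h.trans_eq ?_
  have : ∀ τ : ℝ, ballFactor n (ballGeo p q (s + τ * (t - s))) *
      ‖deriv (fun τ => ballGeo p q (s + τ * (t - s))) τ‖ = |s - t| := fun τ => by
    rw [(hd τ).deriv, norm_smul, Real.norm_eq_abs, abs_sub_comm, mul_left_comm, ballFactor,
      unit_speed_ballGeo hp hq hpq, mul_one]
  simp [this]

/-- The Busemann function of the boundary point `q` of the ball. -/
def busemann {E : Type*} [NormedAddCommGroup E] (q x : E) : ℝ :=
  Real.log (1 - ‖x‖ ^ 2) - Real.log (‖x - q‖ ^ 2)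

lemma norm_sub_pos_of_unit {E : Type*} [NormedAddCommGroup E] {x q : E} (hq : ‖q‖ = 1)
    (hx : ‖x‖ < 1) : 0 < ‖x - q‖ := by
  refine norm_pos_iff.2 (sub_ne_zero.2 ?_)
  rintro rfl
  exact hx.ne hq

/-- The Euclidean gradient of the Busemann function has norm exactly `2/(1-|x|²)`, the conformal
factor. By Cauchy–Schwarz its growth along a curve is at most the length element. -/
lemma busemann_sub_le {q : Euc (n + 1)} (hq : ‖q‖ = 1) {x y : Euc (n + 1)} (hx : x ∈ 𝔹)
    (hy : y ∈ 𝔹) : busemann q y - busemann q x ≤ confDist 𝔹 (ballFactor n) x y := by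
  refine le_confDist (convex_ball _ _) hx hy ?_
  rintro c hc hD rfl rfl
  have hlt : ∀ s ∈ Set.Icc (0 : ℝ) 1, ‖c s‖ < 1 := fun s hs => mem_ball_zero_iff.1 (hD s hs)
  have hder : ∀ s ∈ Set.Icc (0 : ℝ) 1, HasDerivAt (fun s => busemann q (c s))
      (-2 * ⟪(1 - ‖c s‖ ^ 2)⁻¹ • c s + (‖c s - q‖ ^ 2)⁻¹ • (c s - q), deriv c s⟫) s := by
    intro s hs
    have h0 : HasDerivAt c (deriv c s) s := (hc.differentiable one_ne_zero s).hasDerivAt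
    have h1 := (h0.norm_sq.const_sub 1).log (one_sub_norm_sq_pos (hlt s hs)).ne'
    have h2 := (h0.sub_const q).norm_sq.log
      (pow_pos (norm_sub_pos_of_unit hq (hlt s hs)) 2).ne'
    refine (h1.fun_sub h2).congr_deriv ?_
    rw [inner_add_left, real_inner_smul_left, real_inner_smul_left]
    ring
  refine intervalIntegral.sub_le_integral_of_hasDeriv_right_of_le zero_le_one
    (fun s hs => (hder s hs).continuousAt.continuousWithinAt)
    (fun s hs => (hder s (Set.Ioo_subset_Icc_self hs)).hasDerivWithinAt) ?_ ?_
  · refine ContinuousOn.integrableOn_Icc ?_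
    have hcc := hc.continuous
    have hcd := hc.continuous_deriv le_rfl
    have : ∀ s ∈ Set.Icc (0 : ℝ) 1, 1 - ‖c s‖ ^ 2 ≠ 0 := fun s hs =>
      (one_sub_norm_sq_pos (hlt s hs)).ne'
    simp only [ballFactor]
    exact (continuousOn_const.div (by fun_prop) this).mul (by fun_prop)
  · intro s hs
    have hs' := Set.Ioo_subset_Icc_self hs
    have hm := one_sub_norm_sq_pos (hlt s hs')
    have hq' := norm_sub_pos_of_unit hq (hlt s hs')
    -- The vector is minus half the gradient. `|q| = 1` expresses `⟪c s, q⟫` through the two norms.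
    have hn : ‖(1 - ‖c s‖ ^ 2)⁻¹ • c s + (‖c s - q‖ ^ 2)⁻¹ • (c s - q)‖ =
        (1 - ‖c s‖ ^ 2)⁻¹ := by
      rw [← sq_eq_sq₀ (norm_nonneg _) (by positivity), norm_sq_comb, real_inner_comm]
      have h3 := norm_sub_sq_real (c s) q
      rw [inner_sub_right, real_inner_self_eq_norm_sq]
      have h4 : ⟪c s, q⟫ = (‖c s‖ ^ 2 + 1 - ‖c s - q‖ ^ 2) / 2 := by
        rw [h3, hq]; ring
      rw [h4]
      field_simp
      ring
    have h5 := (abs_le.1 (abs_real_inner_le_norm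
      ((1 - ‖c s‖ ^ 2)⁻¹ • c s + (‖c s - q‖ ^ 2)⁻¹ • (c s - q)) (deriv c s))).1
    rw [hn] at h5
    rw [ballFactor, div_eq_mul_inv]
    linarith

lemma busemann_ballGeo {p q : Euc (n + 1)} (hp : ‖p‖ = 1) (hq : ‖q‖ = 1) (hpq : p ≠ q) (s : ℝ) :
    busemann q (ballGeo p q s) = s - Real.log (‖p - q‖ / 2) := by
  have hlt := norm_ballGeo_lt hp hq hpq s
  have hm := one_sub_norm_sq_pos hlt
  have hS := ballGeo_denom_pos p q s
  have hd : 0 < ‖p - q‖ := norm_pos_iff.2 (sub_ne_zero.2 hpq)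
  have he := exp_mul_exp_neg s
  have h1 := one_sub_norm_ballGeo_sq hp hq s
  have h2 : ‖ballGeo p q s‖ ^ 2 = 1 - 2 * ‖p - q‖ / (‖p - q‖ + (Real.exp s + Real.exp (-s))) := by
    linarith
  have h3 : ‖ballGeo p q s - q‖ ^ 2 =
      ‖p - q‖ ^ 2 * Real.exp (-s) / (‖p - q‖ + (Real.exp s + Real.exp (-s))) := by
    rw [norm_sub_sq_real, h2, hq, ballGeo, real_inner_smul_left, inner_add_left,
      real_inner_smul_left, real_inner_smul_left, inner_of_unit hp hq, real_inner_self_eq_norm_sq,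
      hq]
    field_simp
    ring
  rw [busemann, ← Real.log_div hm.ne' (pow_pos (norm_sub_pos_of_unit hq hlt) 2).ne', h1, h3,
    show s - Real.log (‖p - q‖ / 2) = Real.log (Real.exp s / (‖p - q‖ / 2)) by
      rw [Real.log_div (Real.exp_pos s).ne' (by positivity), Real.log_exp]]
  congr 1
  field_simp
  linear_combination -he

/-- The arc itself bounds the distance from above; the Busemann function of `q`, which grows at unit
rate along it, bounds it from below. -/
lemma confDist_ballGeo_of_le {p q : Euc (n + 1)} (hp : ‖p‖ = 1) (hq : ‖q‖ = 1) (hpq : p ≠ q)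
    {s t : ℝ} (hst : s ≤ t) :
    confDist 𝔹 (ballFactor n) (ballGeo p q s) (ballGeo p q t) = t - s := by
  refine le_antisymm ?_ ?_
  · have := confDist_ballGeo_le hp hq hpq s t
    rwa [abs_sub_comm, abs_of_nonneg (sub_nonneg.2 hst)] at this
  · have := busemann_sub_le hq (mem_ball_zero_iff.2 (norm_ballGeo_lt hp hq hpq s))
      (mem_ball_zero_iff.2 (norm_ballGeo_lt hp hq hpq t))
    rw [busemann_ballGeo hp hq hpq, busemann_ballGeo hp hq hpq] at this
    linarith

lemma ballCosh_self {E : Type*} [NormedAddCommGroup E] (x : E) : ballCosh x x = 1 := by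
  simp [ballCosh]

lemma cosh_confDist_ball {x z : Euc (n + 1)} (hx : x ∈ 𝔹) (hz : z ∈ 𝔹) :
    Real.cosh (confDist 𝔹 (ballFactor n) x z) = ballCosh x z := by
  rcases eq_or_ne x z with rfl | hxz
  · have h : confDist 𝔹 (ballFactor n) x x ≤ 0 := by
      have := confDist_le ballFactor_nonneg (c := fun _ => x) contDiff_const fun _ _ => hx
      simpa using this
    rw [le_antisymm h (confDist_nonneg ballFactor_nonneg x x), ballCosh_self, Real.cosh_zero]
  · obtain ⟨p, q, s, t, hp, hq, hpq, hst, rfl, rfl⟩ :=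
      exists_ballGeo_through (mem_ball_zero_iff.1 hx) (mem_ball_zero_iff.1 hz) hxz
    rw [confDist_ballGeo_of_le hp hq hpq hst.le, ballCosh_ballGeo_ballGeo hp hq hpq,
      ← Real.cosh_neg, neg_sub]

lemma isGeodesicLine_ballGeo {p q : Euc (n + 1)} (hp : ‖p‖ = 1) (hq : ‖q‖ = 1) (hpq : p ≠ q) :
    IsGeodesicLine 𝔹 (ballFactor n) (ballGeo p q) := by
  have hm : ∀ s, ballGeo p q s ∈ 𝔹 := fun s => mem_ball_zero_iff.2 (norm_ballGeo_lt hp hq hpq s)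
  refine ⟨hm, fun s t => ?_⟩
  have h := cosh_confDist_ball (hm s) (hm t)
  rw [ballCosh_ballGeo_ballGeo hp hq hpq] at h
  rw [← abs_of_nonneg (confDist_nonneg ballFactor_nonneg (ballGeo p q s) (ballGeo p q t))]
  exact le_antisymm (Real.cosh_le_cosh.1 h.le) (Real.cosh_le_cosh.1 h.ge)

/-- Fix `s` and compare `cosh` of the distance from `c s` along the two curves. Along `c` it is
`cosh (s - r)`, along `ballGeo` it is `a e^r + b e^{-r}`. The values and first derivatives at the
common point agree, since they depend only on position and velocity. This determines `a` and `b`,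
and then the distance from `c s` to the expected point of `ballGeo` vanishes. Differentiability of
`c` is used at `t` only. -/
lemma eq_ballGeo_of_isGeodesicLine {p q : Euc (n + 1)} (hp : ‖p‖ = 1) (hq : ‖q‖ = 1)
    (hpq : p ≠ q) {c : ℝ → Euc (n + 1)} (hc : IsGeodesicLine 𝔹 (ballFactor n) c) {t u : ℝ}
    (h0 : c t = ballGeo p q u) (h1 : HasDerivAt c (ballGeoVel p q u) t) (s : ℝ) :
    c s = ballGeo p q (s - t + u) := by
  have hlt : ∀ r, ‖c r‖ < 1 := fun r => mem_ball_zero_iff.1 (hc.1 r)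
  have hm := one_sub_norm_sq_pos (hlt s)
  have hd : 0 < ‖p - q‖ := norm_pos_iff.2 (sub_ne_zero.2 hpq)
  have hB : ∀ r, ballCosh (c s) (c r) = Real.cosh (s - r) := fun r => by
    rw [← cosh_confDist_ball (hc.1 s) (hc.1 r), hc.2, Real.cosh_abs]
  have hF : DifferentiableAt ℝ (ballCosh (c s)) (c t) := by
    have : (1 - ‖c s‖ ^ 2) * (1 - ‖c t‖ ^ 2) ≠ 0 :=
      (mul_pos hm (one_sub_norm_sq_pos (hlt t))).ne'
    unfold ballCosh
    have h2 : DifferentiableAt ℝ (fun y : Euc (n + 1) => ‖y‖ ^ 2) (c t) :=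
      differentiableAt_id.norm_sq ℝ
    have h3 : DifferentiableAt ℝ (fun y : Euc (n + 1) => ‖c s - y‖ ^ 2) (c t) :=
      (differentiableAt_id.const_sub (c s)).norm_sq ℝ
    have h4 : DifferentiableAt ℝ (fun y : Euc (n + 1) => (1 - ‖c s‖ ^ 2) * (1 - ‖y‖ ^ 2)) (c t) :=
      (h2.const_sub 1).const_mul _
    simp only [div_eq_mul_inv]
    exact ((h3.const_mul 2).fun_mul (h4.fun_inv this)).const_add 1
  set F' := fderiv ℝ (ballCosh (c s)) (c t)
  have hk := hF.hasFDerivAt.comp_hasDerivAt t h1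
  have hk' : HasDerivAt (fun r => ballCosh (c s) (c r)) (-Real.sinh (s - t)) t := by
    simp only [hB]
    simpa using ((hasDerivAt_id t).const_sub s).cosh
  have e1 := hk.unique hk'
  rw [h0] at hF
  have hg := hF.hasFDerivAt.comp_hasDerivAt u (hasDerivAt_ballGeo p q u)
  set a := ‖c s - q‖ ^ 2 / ((1 - ‖c s‖ ^ 2) * ‖p - q‖) with ha
  set b := ‖c s - p‖ ^ 2 / ((1 - ‖c s‖ ^ 2) * ‖p - q‖) with hb
  have hG : ∀ r, ballCosh (c s) (ballGeo p q r) = a * Real.exp r + b * Real.exp (-r) := fun r => by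
    rw [ballCosh_ballGeo hp hq hpq (hlt s), ha, hb]; ring
  have hg' : HasDerivAt (fun r => ballCosh (c s) (ballGeo p q r))
      (a * Real.exp u - b * Real.exp (-u)) u := by
    simp only [hG]
    refine (((Real.hasDerivAt_exp u).const_mul a).fun_add
      (((hasDerivAt_neg u).exp).const_mul b)).congr_deriv ?_
    ring
  have e2 := hg.unique hg'
  have e3 : a * Real.exp u - b * Real.exp (-u) = -Real.sinh (s - t) := by
    rw [← e2, ← e1]; simp only [h0]
  have e4 : a * Real.exp u + b * Real.exp (-u) = Real.cosh (s - t) := by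
    rw [← hG, ← h0, hB]
  rw [Real.sinh_eq] at e3
  rw [Real.cosh_eq] at e4
  -- By `e3` and `e4`, `a e^u = e^{-(s-t)}/2` and `b e^{-u} = e^{s-t}/2`, so both summands equal
  -- `1/2`.
  have e5 : ballCosh (c s) (ballGeo p q (s - t + u)) = 1 := by
    rw [hG, neg_add, Real.exp_add, Real.exp_add]
    have := exp_mul_exp_neg (s - t)
    linear_combination this + (Real.exp (s - t) - Real.exp (-(s - t))) * e3 / 2 +
      (Real.exp (s - t) + Real.exp (-(s - t))) * e4 / 2
  by_contra hne
  exact (one_lt_ballCosh (hlt s) (norm_ballGeo_lt hp hq hpq _) hne).ne' e5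

lemma ballCosh_zero_ballGeo {p q : Euc (n + 1)} (hp : ‖p‖ = 1) (hq : ‖q‖ = 1) (hpq : p ≠ q)
    (s : ℝ) : ballCosh 0 (ballGeo p q s) = 2 * Real.cosh s / ‖p - q‖ := by
  rw [ballCosh_ballGeo hp hq hpq (by simp)]
  simp [hp, hq, Real.cosh_eq]
  ring

lemma confDist_zero_ballGeo_le_iff {p q : Euc (n + 1)} (hp : ‖p‖ = 1) (hq : ‖q‖ = 1)
    (hpq : p ≠ q) (s t : ℝ) :
    confDist 𝔹 (ballFactor n) 0 (ballGeo p q s) ≤ confDist 𝔹 (ballFactor n) 0 (ballGeo p q t) ↔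
      |s| ≤ |t| := by
  have hd : 0 < ‖p - q‖ := norm_pos_iff.2 (sub_ne_zero.2 hpq)
  have h0 : (0 : Euc (n + 1)) ∈ 𝔹 := by simp
  have hm : ∀ s, ballGeo p q s ∈ 𝔹 := fun s => mem_ball_zero_iff.2 (norm_ballGeo_lt hp hq hpq s)
  rw [← Real.cosh_le_cosh (x := s), ← abs_of_nonneg (confDist_nonneg ballFactor_nonneg 0 (ballGeo p q s)),
    ← abs_of_nonneg (confDist_nonneg ballFactor_nonneg 0 (ballGeo p q t)), ← Real.cosh_le_cosh,
    cosh_confDist_ball h0 (hm s), cosh_confDist_ball h0 (hm t), ballCosh_zero_ballGeo hp hq hpq,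
    ballCosh_zero_ballGeo hp hq hpq, div_le_div_iff_of_pos_right hd]
  constructor <;> intro h <;> linarith

lemma tendsto_ballGeo_atTop (p q : Euc (n + 1)) : Tendsto (ballGeo p q) atTop (𝓝 q) := by
  have h0 : Tendsto (fun s : ℝ => Real.exp (-s)) atTop (𝓝 0) :=
    Real.tendsto_exp_neg_atTop_nhds_zero
  -- Numerator and denominator are multiplied by `e^{-s}`, which leaves only terms with a limit.
  have h1 : Tendsto (fun s : ℝ => (‖p - q‖ * Real.exp (-s) + (1 + Real.exp (-s) * Real.exp (-s)))⁻¹ •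
      (q + (Real.exp (-s) * Real.exp (-s)) • p)) atTop
      (𝓝 ((‖p - q‖ * 0 + (1 + 0 * 0))⁻¹ • (q + (0 * 0 : ℝ) • p))) :=
    (((h0.const_mul _).add ((h0.mul h0).const_add 1)).inv₀ (by simp)).smul
      (((h0.mul h0).smul_const p).const_add q)
  have h2 : (‖p - q‖ * 0 + (1 + 0 * 0))⁻¹ • (q + (0 * 0 : ℝ) • p) = q := by simp
  rw [h2] at h1
  refine h1.congr fun s => ?_
  have hS := ballGeo_denom_pos p q s
  have he := exp_mul_exp_neg s
  have hb : 0 < Real.exp (-s) := Real.exp_pos _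
  have e1 : ‖p - q‖ * Real.exp (-s) + (1 + Real.exp (-s) * Real.exp (-s)) =
      Real.exp (-s) * (‖p - q‖ + (Real.exp s + Real.exp (-s))) := by
    linear_combination -he
  have e2 : q + (Real.exp (-s) * Real.exp (-s)) • p =
      Real.exp (-s) • (Real.exp s • q + Real.exp (-s) • p) := by
    rw [smul_add, ← mul_smul, ← mul_smul, mul_comm (Real.exp (-s)) (Real.exp s), he, one_smul]
  rw [ballGeo, e1, e2, inv_smul_eq_iff₀ (mul_pos hb hS).ne', ← mul_smul, mul_assoc,
    mul_inv_cancel₀ hS.ne', mul_one]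

lemma ballGeo_neg (p q : Euc (n + 1)) (s : ℝ) : ballGeo p q (-s) = ballGeo q p s := by
  rw [ballGeo, ballGeo, neg_neg, norm_sub_rev, add_comm (Real.exp s), add_comm (Real.exp s • p)]

lemma tendsto_ballGeo_atBot (p q : Euc (n + 1)) : Tendsto (ballGeo p q) atBot (𝓝 p) := by
  refine ((tendsto_ballGeo_atTop q p).comp tendsto_neg_atBot_atTop).congr fun s => ?_
  rw [Function.comp_apply, ← ballGeo_neg, neg_neg]

end BallDist

/-! ### Borel inverses of Borel bijections. -/

section Measurability

/-- Lusin–Souslin: an injective Borel map from a standard Borel space sends Borel sets to Borel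
sets. -/
lemma exists_measurableEquiv_of_bijective {α β : Type*} [MeasurableSpace α] [MeasurableSpace β]
    [StandardBorelSpace α] [MeasurableSpace.CountablySeparated β] {f : α → β} (hf : Measurable f)
    (hb : Function.Bijective f) : ∃ e : α ≃ᵐ β, ∀ a, e a = f a := by
  have he := hf.measurableEmbedding hb.1
  refine ⟨⟨Equiv.ofBijective f hb, hf, ?_⟩, fun _ => rfl⟩
  intro s hs
  rw [← Equiv.image_eq_preimage_symm]
  exact he.measurableSet_image.2 hs

end Measurability

/-! ### Endpoint coordinates in the ball. -/

section BallCoord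

variable {n : ℕ}

lemma norm_coe_sph {N : ℕ} (p : Sph N) : ‖(p : Euc N)‖ = 1 := norm_eq_of_mem_sphere p

lemma ballTriples_ne (p : BallTriples n) : (p.1.1 : Euc (n + 1)) ≠ p.1.2.1 :=
  fun h => p.2 (Subtype.ext h)

/-- The unit tangent vector of the ball with given geodesic endpoint coordinates. -/
def ballTangent (p : BallTriples n) : BallUT n :=
  ⟨(ballGeo (p.1.1 : Euc (n + 1)) p.1.2.1 p.1.2.2, ballGeoVel (p.1.1 : Euc (n + 1)) p.1.2.1 p.1.2.2),
    mem_ball_zero_iff.2 (norm_ballGeo_lt (norm_coe_sph _) (norm_coe_sph _) (ballTriples_ne p) _),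
    unit_speed_ballGeo (norm_coe_sph _) (norm_coe_sph _) (ballTriples_ne p) _⟩

lemma measurable_ballTangent : Measurable (ballTangent (n := n)) := by
  refine Measurable.subtype_mk (Continuous.measurable ?_)
  have h : ∀ p : BallTriples n, ‖(p.1.1 : Euc (n + 1)) - p.1.2.1‖ +
    (Real.exp p.1.2.2 + Real.exp (-p.1.2.2)) ≠ 0 := fun p => (ballGeo_denom_pos _ _ _).ne'
  unfold ballGeo ballGeoVel
  fun_prop (disch := assumption)

lemma surjective_ballTangent : Function.Surjective (ballTangent (n := n)) := by
  rintro ⟨⟨x, v⟩, hx, hv⟩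
  obtain ⟨p, q, t, hp, hq, hpq, rfl, rfl⟩ := exists_ballGeo_tangent (mem_ball_zero_iff.1 hx) hv
  exact ⟨⟨(⟨p, mem_sphere_zero_iff_norm.2 hp⟩, ⟨q, mem_sphere_zero_iff_norm.2 hq⟩, t),
    fun h => hpq (congrArg Subtype.val h)⟩, rfl⟩

lemma isBallCoord_ballTangent (p : BallTriples n) : IsBallCoord n (ballTangent p) p := by
  have hp := norm_coe_sph p.1.1
  have hq := norm_coe_sph p.1.2.1
  have hpq := ballTriples_ne p
  refine ⟨ballGeo p.1.1 p.1.2.1, ⟨isGeodesicLine_ballGeo hp hq hpq, fun s => ?_, rfl,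
    hasDerivAt_ballGeo _ _ _⟩, tendsto_ballGeo_atBot _ _, tendsto_ballGeo_atTop _ _⟩
  rw [confDist_zero_ballGeo_le_iff hp hq hpq, abs_zero]
  exact abs_nonneg s

lemma eq_of_isBallCoord_ballTangent {p p' : BallTriples n} (h : IsBallCoord n (ballTangent p) p') :
    p = p' := by
  obtain ⟨c, ⟨hc, hmin, h0, h1⟩, hbot, htop⟩ := h
  have hp := norm_coe_sph p.1.1
  have hq := norm_coe_sph p.1.2.1
  have hpq := ballTriples_ne p
  have hcs := eq_ballGeo_of_isGeodesicLine hp hq hpq hc h0 h1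
  have ht : p.1.2.2 = p'.1.2.2 := by
    -- At this parameter `c` passes through `ballGeo` at `0`, the unique closest point to the
    -- origin. Minimality of `c 0` therefore forces the two values of `t` to agree.
    have h2 := hmin (p'.1.2.2 - p.1.2.2)
    rw [hcs, hcs, confDist_zero_ballGeo_le_iff hp hq hpq] at h2
    have h3 : p'.1.2.2 - p.1.2.2 - p'.1.2.2 + p.1.2.2 = 0 := by ring
    rw [h3, abs_zero] at h2
    have := abs_nonpos_iff.1 h2
    linarith
  have hc' : c = ballGeo (p.1.1 : Euc (n + 1)) p.1.2.1 := by
    ext1 s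
    rw [hcs, ht, sub_add_cancel]
  subst hc'
  have e1 := tendsto_nhds_unique hbot (tendsto_ballGeo_atBot _ _)
  have e2 := tendsto_nhds_unique htop (tendsto_ballGeo_atTop _ _)
  exact Subtype.ext (Prod.ext (Subtype.ext e1.symm) (Prod.ext (Subtype.ext e2.symm) ht))

lemma measurableSet_ballTriples :
    MeasurableSet {p : Sph (n + 1) × Sph (n + 1) × ℝ | p.1 ≠ p.2.1} :=
  (measurableSet_eq_fun measurable_fst (measurable_fst.comp measurable_snd)).compl

theorem exists_ballCoord (n : ℕ) :
    ∃ Φ : BallUT n ≃ᵐ BallTriples n, ∀ v p, IsBallCoord n v p ↔ Φ v = p := by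
  have hinj : Function.Injective (ballTangent (n := n)) := fun p p' h =>
    eq_of_isBallCoord_ballTangent (h ▸ isBallCoord_ballTangent p')
  have : PolishSpace (Sph (n + 1)) := isClosed_sphere.polishSpace
  have : StandardBorelSpace (BallTriples n) := measurableSet_ballTriples.standardBorel
  obtain ⟨e, he⟩ := exists_measurableEquiv_of_bijective measurable_ballTangent
    ⟨hinj, surjective_ballTangent⟩
  refine ⟨e.symm, fun v p => ?_⟩
  obtain ⟨p', rfl⟩ := surjective_ballTangent v
  rw [← he, e.symm_apply_apply, he]
  refine ⟨eq_of_isBallCoord_ballTangent, ?_⟩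
  rintro rfl
  exact isBallCoord_ballTangent p'

end BallCoord

/-! ### Conformal maps, distances and geodesics. -/

section ConformalMap

variable {N : ℕ} {D₁ D₂ : Set (Euc N)} {lam₁ lam₂ : Euc N → ℝ} {σ : Euc N → Euc N}

/-- A conformal map does not increase the distance. -/
lemma confDist_map_le (hconv : Convex ℝ D₁) (hopen : IsOpen D₁)
    (hlam : ∀ x ∈ D₂, 0 ≤ lam₂ x)
    (hmaps : Set.MapsTo σ D₁ D₂) (hσ : ContDiffOn ℝ 1 σ D₁)
    (hconf : ∀ x ∈ D₁, ∀ w, lam₂ (σ x) * ‖fderiv ℝ σ x w‖ = lam₁ x * ‖w‖) {x y : Euc N}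
    (hx : x ∈ D₁) (hy : y ∈ D₁) :
    confDist D₂ lam₂ (σ x) (σ y) ≤ confDist D₁ lam₁ x y := by
  refine le_confDist hconv hx hy ?_
  rintro c hc hD rfl rfl
  -- Competitors must be `C¹` on all of `ℝ`, but `c` may leave `D₁` outside `[0,1]`, where `σ` is
  -- not controlled. The reparametrization `φ` maps `ℝ` into `[0,1]`, fixes `0` and `1` and is
  -- monotone on `[0,1]`, so `σ ∘ c ∘ φ` is admissible and the length integral is unchanged.
  set φ : ℝ → ℝ := fun s => (1 - Real.cos (Real.pi * s)) / 2 with hφ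
  set φ' : ℝ → ℝ := fun s => Real.pi * Real.sin (Real.pi * s) / 2 with hφ'
  have h01 : ∀ s, φ s ∈ Set.Icc (0 : ℝ) 1 := fun s => by
    constructor
    · have := Real.cos_le_one (Real.pi * s); simp only [hφ]; linarith
    · have := Real.neg_one_le_cos (Real.pi * s); simp only [hφ]; linarith
  have hφd : ∀ s, HasDerivAt φ (φ' s) s := fun s => by
    have h1 : HasDerivAt (fun s : ℝ => Real.pi * s) Real.pi s := by
      simpa using (hasDerivAt_id s).const_mul Real.pi
    refine ((h1.cos.const_sub 1).div_const 2).congr_deriv ?_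
    simp only [hφ']; ring
  have hφ0 : φ 0 = 0 := by simp [hφ]
  have hφ1 : φ 1 = 1 := by simp [hφ]
  have hφpos : ∀ s ∈ Set.Icc (0 : ℝ) 1, 0 ≤ φ' s := fun s hs => by
    have : 0 ≤ Real.sin (Real.pi * s) := Real.sin_nonneg_of_nonneg_of_le_pi
      (mul_nonneg Real.pi_pos.le hs.1) (mul_le_of_le_one_right Real.pi_pos.le hs.2)
    have := Real.pi_pos
    simp only [hφ']; positivity
  have hφc : ContDiff ℝ 1 φ := by simp only [hφ]; fun_prop
  have hder : ∀ s, HasDerivAt (fun s => σ (c (φ s)))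
      (fderiv ℝ σ (c (φ s)) (φ' s • deriv c (φ s))) s := fun s => by
    have h1 := ((hc.differentiable one_ne_zero (φ s)).hasDerivAt).scomp s (hφd s)
    have h2 := ((hσ.differentiableOn one_ne_zero).differentiableAt
      (hopen.mem_nhds (hD _ (h01 s)))).hasFDerivAt
    exact h2.comp_hasDerivAt s h1
  have h := confDist_le hlam (c := fun s => σ (c (φ s)))
    (hσ.comp_contDiff (hc.comp hφc) fun s => hD _ (h01 s)) fun s _ => hmaps (hD _ (h01 s))
  simp only [hφ0, hφ1] at h
  refine h.trans_eq ?_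
  have h3 := intervalIntegral.integral_comp_mul_deriv_of_deriv_nonneg (a := 0) (b := 1)
    (f := φ) (f' := φ') (g := fun s => lam₁ (c s) * ‖deriv c s‖) hφc.continuous.continuousOn
    (fun s _ => hφd s) (fun s hs => hφpos s (by simpa using Set.Ioo_subset_Icc_self hs))
  rw [hφ0, hφ1] at h3
  rw [← h3]
  refine intervalIntegral.integral_congr fun s hs => ?_
  rw [Set.uIcc_of_le zero_le_one] at hs
  simp only [Function.comp_apply]
  rw [(hder s).deriv, hconf _ (hD _ (h01 s)), norm_smul, Real.norm_eq_abs,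
    abs_of_nonneg (hφpos s hs)]
  ring

lemma IsGeodesicOf.map (hopen : IsOpen D₁) (hmaps : Set.MapsTo σ D₁ D₂)
    (hσ : ContDiffOn ℝ 1 σ D₁)
    (hd : ∀ x ∈ D₁, ∀ y ∈ D₁, confDist D₂ lam₂ (σ x) (σ y) = confDist D₁ lam₁ x y)
    {O : Euc N} (hO : O ∈ D₁) {v : UnitTangent D₁ lam₁} {w : UnitTangent D₂ lam₂}
    (hvw : w.1 = (σ v.1.1, fderiv ℝ σ v.1.1 v.1.2)) {c : ℝ → Euc N} {t : ℝ}
    (h : IsGeodesicOf D₁ lam₁ O v c t) : IsGeodesicOf D₂ lam₂ (σ O) w (σ ∘ c) t := by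
  obtain ⟨⟨hc, hiso⟩, hmin, h0, h1⟩ := h
  refine ⟨⟨fun s => hmaps (hc s), fun s t => ?_⟩, fun s => ?_, ?_, ?_⟩
  · rw [Function.comp_apply, Function.comp_apply, hd _ (hc s) _ (hc t), hiso]
  · rw [Function.comp_apply, Function.comp_apply, hd _ hO _ (hc _), hd _ hO _ (hc _)]
    exact hmin s
  · rw [Function.comp_apply, h0, hvw]
  · rw [hvw]
    have h2 := ((hσ.differentiableOn one_ne_zero).differentiableAt
      (hopen.mem_nhds (hc t))).hasFDerivAt
    rw [← h0]
    exact h2.comp_hasDerivAt t h1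

end ConformalMap

/-! ### The inversion between half-space and ball. -/

section Cayley

variable {n : ℕ}

local notation "𝔹" => ball (0 : Euc (n + 1)) 1

/-- The inversion exchanging the upper half-space and the unit ball. -/
def cayley (n : ℕ) : Euc (n + 1) → Euc (n + 1) :=
  EuclideanGeometry.inversion (-upperBase n) (√2)

lemma cayley_eq (x : Euc (n + 1)) :
    cayley n x = (2 / ‖x + upperBase n‖ ^ 2) • (x + upperBase n) - upperBase n := by
  simp [cayley, EuclideanGeometry.inversion, div_pow, dist_eq_norm, sub_eq_add_neg]

lemma cayley_cayley (x : Euc (n + 1)) : cayley n (cayley n x) = x :=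
  EuclideanGeometry.inversion_inversion _ (by positivity) x

lemma norm_upperBase : ‖upperBase n‖ = 1 := by simp [upperBase]

lemma inner_upperBase (x : Euc (n + 1)) : inner ℝ x (upperBase n) = x (Fin.last n) := by
  simp [upperBase, EuclideanSpace.inner_single_right]

lemma norm_add_upperBase_sq (x : Euc (n + 1)) :
    ‖x + upperBase n‖ ^ 2 = ‖x‖ ^ 2 + 2 * x (Fin.last n) + 1 := by
  rw [norm_add_sq_real, norm_upperBase, inner_upperBase]; ring

lemma upperBase_last : upperBase n (Fin.last n) = 1 := by simp [upperBase]

lemma one_sub_norm_cayley_sq {x : Euc (n + 1)} (hx : x ≠ -upperBase n) :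
    1 - ‖cayley n x‖ ^ 2 = 4 * x (Fin.last n) / ‖x + upperBase n‖ ^ 2 := by
  have h : ‖x + upperBase n‖ ≠ 0 :=
    norm_ne_zero_iff.2 fun h => hx (eq_neg_of_add_eq_zero_left h)
  rw [cayley_eq, norm_sub_sq_real, norm_smul, mul_pow, Real.norm_eq_abs, sq_abs,
    real_inner_smul_left, inner_add_left, inner_upperBase, real_inner_self_eq_norm_sq,
    norm_upperBase]
  field_simp
  ring

lemma cayley_last {x : Euc (n + 1)} (hx : x ≠ -upperBase n) :
    cayley n x (Fin.last n) = (1 - ‖x‖ ^ 2) / ‖x + upperBase n‖ ^ 2 := by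
  have h : ‖x + upperBase n‖ ≠ 0 :=
    norm_ne_zero_iff.2 fun h => hx (eq_neg_of_add_eq_zero_left h)
  rw [cayley_eq]
  simp only [PiLp.sub_apply, PiLp.smul_apply, PiLp.add_apply, upperBase_last, smul_eq_mul]
  have := norm_add_upperBase_sq x
  field_simp
  linarith

lemma ne_of_mem_upper {x : Euc (n + 1)} (hx : x ∈ upper n) : x ≠ -upperBase n := by
  rintro rfl
  have : (0 : ℝ) < (-upperBase n) (Fin.last n) := hx
  rw [PiLp.neg_apply, upperBase_last] at this
  linarith

lemma ne_of_mem_ball {x : Euc (n + 1)} (hx : x ∈ 𝔹) : x ≠ -upperBase n := by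
  rintro rfl
  have := mem_ball_zero_iff.1 hx
  rw [norm_neg, norm_upperBase] at this
  exact this.false

lemma norm_add_upperBase_pos {x : Euc (n + 1)} (hx : x ≠ -upperBase n) :
    0 < ‖x + upperBase n‖ :=
  norm_pos_iff.2 fun h => hx (eq_neg_of_add_eq_zero_left h)

lemma cayley_mem_ball {x : Euc (n + 1)} (hx : x ∈ upper n) : cayley n x ∈ 𝔹 := by
  have h1 := one_sub_norm_cayley_sq (ne_of_mem_upper hx)
  have h2 := norm_add_upperBase_pos (ne_of_mem_upper hx)
  have hx' : (0 : ℝ) < x (Fin.last n) := hx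
  have : 0 < 1 - ‖cayley n x‖ ^ 2 := by rw [h1]; positivity
  rw [mem_ball_zero_iff]
  nlinarith [norm_nonneg (cayley n x)]

lemma cayley_mem_upper {x : Euc (n + 1)} (hx : x ∈ 𝔹) : cayley n x ∈ upper n := by
  have h1 := cayley_last (ne_of_mem_ball hx)
  have h2 := norm_add_upperBase_pos (ne_of_mem_ball hx)
  have h3 := one_sub_norm_sq_pos (mem_ball_zero_iff.1 hx)
  change (0 : ℝ) < cayley n x (Fin.last n)
  rw [h1]; positivity

/-- The orthogonal part of the derivative of `cayley`. -/
def cayleyRefl (x : Euc (n + 1)) : Euc (n + 1) ≃ₗᵢ[ℝ] Euc (n + 1) :=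
  (ℝ ∙ (x + upperBase n))ᗮ.reflection

lemma cayleyRefl_apply (x w : Euc (n + 1)) : cayleyRefl x w =
    w - (2 * (inner ℝ (x + upperBase n) w / ‖x + upperBase n‖ ^ 2)) • (x + upperBase n) := by
  rw [cayleyRefl, Submodule.reflection_orthogonal_apply, Submodule.reflection_singleton_apply,
    neg_sub, mul_smul]
  simp [two_smul]

lemma hasFDerivAt_cayley {x : Euc (n + 1)} (hx : x ≠ -upperBase n) :
    HasFDerivAt (cayley n)
      ((2 / ‖x + upperBase n‖ ^ 2) • (cayleyRefl x : Euc (n + 1) →L[ℝ] Euc (n + 1))) x := by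
  have h := EuclideanGeometry.hasFDerivAt_inversion (R := √2) hx
  rw [div_pow, Real.sq_sqrt zero_le_two, dist_eq_norm, sub_neg_eq_add] at h
  exact h

lemma fderiv_cayley {x : Euc (n + 1)} (hx : x ≠ -upperBase n) (w : Euc (n + 1)) :
    fderiv ℝ (cayley n) x w = (2 / ‖x + upperBase n‖ ^ 2) • cayleyRefl x w := by
  rw [(hasFDerivAt_cayley hx).fderiv]; rfl

lemma cayley_upper_conf {x : Euc (n + 1)} (hx : x ∈ upper n) :
    ballFactor n (cayley n x) * (2 / ‖x + upperBase n‖ ^ 2) = upperFactor n x := by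
  have h2 := norm_add_upperBase_pos (ne_of_mem_upper hx)
  have hx' : (0 : ℝ) < x (Fin.last n) := hx
  rw [ballFactor, one_sub_norm_cayley_sq (ne_of_mem_upper hx), upperFactor]
  field_simp
  norm_num

lemma cayley_ball_conf {x : Euc (n + 1)} (hx : x ∈ 𝔹) :
    upperFactor n (cayley n x) * (2 / ‖x + upperBase n‖ ^ 2) = ballFactor n x := by
  have h2 := norm_add_upperBase_pos (ne_of_mem_ball hx)
  have h3 := one_sub_norm_sq_pos (mem_ball_zero_iff.1 hx)
  rw [ballFactor, upperFactor, cayley_last (ne_of_mem_ball hx)]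
  field_simp

lemma contDiffOn_cayley {s : Set (Euc (n + 1))} (hs : ∀ x ∈ s, x ≠ -upperBase n) :
    ContDiffOn ℝ 1 (cayley n) s :=
  ContDiffOn.inversion contDiffOn_const contDiffOn_const contDiffOn_id hs

lemma upperFactor_nonneg : ∀ x ∈ upper n, 0 ≤ upperFactor n x := by
  intro x hx
  have : (0 : ℝ) < x (Fin.last n) := hx
  rw [upperFactor]; positivity

lemma isOpen_upper : IsOpen (upper n) :=
  isOpen_lt continuous_const (by fun_prop)

lemma convex_upper : Convex ℝ (upper n) := by
  intro x hx y hy a b ha hb hab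
  have hx' : (0 : ℝ) < x (Fin.last n) := hx
  have hy' : (0 : ℝ) < y (Fin.last n) := hy
  change (0 : ℝ) < (a • x + b • y) (Fin.last n)
  simp only [PiLp.add_apply, PiLp.smul_apply, smul_eq_mul]
  rcases ha.eq_or_lt with rfl | ha
  · have : b = 1 := by linarith
    subst this; simpa using hy'
  · have := mul_pos ha hx'
    have := mul_nonneg hb hy'.le
    linarith

lemma cayley_upper_norm {x : Euc (n + 1)} (hx : x ∈ upper n) (w : Euc (n + 1)) :
    ballFactor n (cayley n x) * ‖fderiv ℝ (cayley n) x w‖ = upperFactor n x * ‖w‖ := by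
  rw [fderiv_cayley (ne_of_mem_upper hx), norm_smul, LinearIsometryEquiv.norm_map,
    Real.norm_of_nonneg (by positivity), ← mul_assoc, cayley_upper_conf hx]

lemma cayley_ball_norm {x : Euc (n + 1)} (hx : x ∈ 𝔹) (w : Euc (n + 1)) :
    upperFactor n (cayley n x) * ‖fderiv ℝ (cayley n) x w‖ = ballFactor n x * ‖w‖ := by
  rw [fderiv_cayley (ne_of_mem_ball hx), norm_smul, LinearIsometryEquiv.norm_map,
    Real.norm_of_nonneg (by positivity), ← mul_assoc, cayley_ball_conf hx]

/-- `cayley` does not increase distances in either direction, and it is its own inverse. -/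
lemma confDist_cayley_upper {x y : Euc (n + 1)} (hx : x ∈ upper n) (hy : y ∈ upper n) :
    confDist 𝔹 (ballFactor n) (cayley n x) (cayley n y) =
      confDist (upper n) (upperFactor n) x y := by
  refine le_antisymm (confDist_map_le convex_upper isOpen_upper ballFactor_nonneg
    (fun x => cayley_mem_ball) (contDiffOn_cayley fun x => ne_of_mem_upper)
    (fun x => cayley_upper_norm) hx hy) ?_
  have := confDist_map_le (convex_ball (0 : Euc (n + 1)) 1) isOpen_ball upperFactor_nonneg
    (fun x => cayley_mem_upper) (contDiffOn_cayley fun x => ne_of_mem_ball)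
    (fun x => cayley_ball_norm) (cayley_mem_ball hx) (cayley_mem_ball hy)
  rwa [cayley_cayley, cayley_cayley] at this

lemma confDist_cayley_ball {x y : Euc (n + 1)} (hx : x ∈ 𝔹) (hy : y ∈ 𝔹) :
    confDist (upper n) (upperFactor n) (cayley n x) (cayley n y) =
      confDist 𝔹 (ballFactor n) x y := by
  rw [← confDist_cayley_upper (cayley_mem_upper hx) (cayley_mem_upper hy), cayley_cayley,
    cayley_cayley]

lemma cayley_base : cayley n (upperBase n) = 0 := by
  rw [cayley_eq, ← two_smul ℝ, norm_smul, norm_upperBase, ← mul_smul]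
  norm_num

lemma cayley_zero : cayley n 0 = upperBase n := by
  rw [← cayley_base, cayley_cayley]

lemma upperBase_mem : upperBase n ∈ upper n := by
  change (0 : ℝ) < upperBase n (Fin.last n)
  rw [upperBase_last]; exact one_pos

/-- The map induced by `cayley` on tangent vectors. -/
def cayleyTangent (v : Euc (n + 1) × Euc (n + 1)) : Euc (n + 1) × Euc (n + 1) :=
  (cayley n v.1, (2 / ‖v.1 + upperBase n‖ ^ 2) • cayleyRefl v.1 v.2)

lemma measurable_cayley : Measurable (cayley n) := by
  rw [funext (cayley_eq (n := n))]
  fun_prop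

lemma measurable_cayleyRefl :
    Measurable fun v : Euc (n + 1) × Euc (n + 1) => cayleyRefl v.1 v.2 := by
  simp only [cayleyRefl_apply]
  fun_prop

lemma measurable_cayleyTangent : Measurable (cayleyTangent (n := n)) := by
  have := measurable_cayley (n := n)
  have := measurable_cayleyRefl (n := n)
  unfold cayleyTangent
  fun_prop

lemma cayleyTangent_eq_fderiv {v : Euc (n + 1) × Euc (n + 1)} (hv : v.1 ≠ -upperBase n) :
    cayleyTangent v = (cayley n v.1, fderiv ℝ (cayley n) v.1 v.2) := by
  rw [cayleyTangent, fderiv_cayley hv]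

lemma cayley_ne {x : Euc (n + 1)} (hx : x ≠ -upperBase n) : cayley n x ≠ -upperBase n := by
  rwa [cayley, Ne, EuclideanGeometry.inversion_eq_center (by positivity)]

/-- The chain rule for the involution: the derivatives at `x` and at its image are inverse to each
other. -/
lemma cayleyTangent_cayleyTangent {v : Euc (n + 1) × Euc (n + 1)} (hv : v.1 ≠ -upperBase n) :
    cayleyTangent (cayleyTangent v) = v := by
  have h1 := hasFDerivAt_cayley (cayley_ne hv)
  have h2 := (h1.comp v.1 (hasFDerivAt_cayley hv)).unique
    ((hasFDerivAt_id v.1).congr_of_eventuallyEq (.of_forall cayley_cayley))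
  refine Prod.ext (cayley_cayley _) ?_
  exact congrArg (fun L : Euc (n + 1) →L[ℝ] Euc (n + 1) => L v.2) h2

/-- The isometry `cayley` acting on unit tangent bundles. -/
def cayleyUT (n : ℕ) : UpperUT n ≃ᵐ BallUT n where
  toFun v := ⟨cayleyTangent v.1, cayley_mem_ball v.2.1, by
    rw [cayleyTangent_eq_fderiv (ne_of_mem_upper v.2.1), cayley_upper_norm v.2.1]
    exact v.2.2⟩
  invFun v := ⟨cayleyTangent v.1, cayley_mem_upper v.2.1, by
    rw [cayleyTangent_eq_fderiv (ne_of_mem_ball v.2.1), cayley_ball_norm v.2.1]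
    exact v.2.2⟩
  left_inv v := Subtype.ext (cayleyTangent_cayleyTangent (ne_of_mem_upper v.2.1))
  right_inv v := Subtype.ext (cayleyTangent_cayleyTangent (ne_of_mem_ball v.2.1))
  measurable_toFun := (measurable_cayleyTangent.comp measurable_subtype_coe).subtype_mk
  measurable_invFun := (measurable_cayleyTangent.comp measurable_subtype_coe).subtype_mk

lemma coe_cayleyUT (v : UpperUT n) : (cayleyUT n v).1 = cayleyTangent v.1 := rfl

lemma isGeodesicOf_cayley_upper {v : UpperUT n} {c : ℝ → Euc (n + 1)} {t : ℝ}
    (h : IsGeodesicOf (upper n) (upperFactor n) (upperBase n) v c t) :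
    IsGeodesicOf 𝔹 (ballFactor n) 0 (cayleyUT n v) (cayley n ∘ c) t := by
  have := h.map (w := cayleyUT n v) isOpen_upper (fun x => cayley_mem_ball)
    (contDiffOn_cayley fun x => ne_of_mem_upper)
    (fun x hx y hy => confDist_cayley_upper hx hy) upperBase_mem
    (cayleyTangent_eq_fderiv (ne_of_mem_upper v.2.1))
  rwa [cayley_base] at this

lemma isGeodesicOf_cayley_ball {v : BallUT n} {c : ℝ → Euc (n + 1)} {t : ℝ}
    (h : IsGeodesicOf 𝔹 (ballFactor n) 0 v c t) :
    IsGeodesicOf (upper n) (upperFactor n) (upperBase n) ((cayleyUT n).symm v)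
      (cayley n ∘ c) t := by
  rw [← cayley_zero]
  exact h.map isOpen_ball (fun x => cayley_mem_upper) (contDiffOn_cayley fun x => ne_of_mem_ball)
    (fun x hx y hy => confDist_cayley_ball hx hy) (by simp)
    (cayleyTangent_eq_fderiv (ne_of_mem_ball v.2.1))

end Cayley

/-! ### The boundary sphere and the one-point compactification. -/

section Boundary

variable {n : ℕ}

local notation "𝔹" => ball (0 : Euc (n + 1)) 1

/-- The point of `ℝ^(n+1)` with horizontal part `a` and height `h`. -/
def withHeight (a : Euc n) (h : ℝ) : Euc (n + 1) :=
  WithLp.toLp 2 (Fin.snoc (α := fun _ => ℝ) (fun i => a i) h)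

lemma withHeight_last (a : Euc n) (h : ℝ) : withHeight a h (Fin.last n) = h := by
  simp [withHeight]

lemma withHeight_castSucc (a : Euc n) (h : ℝ) (i : Fin n) :
    withHeight a h i.castSucc = a i := by
  simp [withHeight]

lemma ext_withHeight {z w : Euc (n + 1)} (h1 : ∀ i : Fin n, z i.castSucc = w i.castSucc)
    (h2 : z (Fin.last n) = w (Fin.last n)) : z = w := by
  ext i
  refine Fin.lastCases h2 h1 i

lemma withHeight_add (a b : Euc n) (h k : ℝ) :
    withHeight a h + withHeight b k = withHeight (a + b) (h + k) := by
  refine ext_withHeight (fun i => ?_) ?_ <;>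
    simp [withHeight_last, withHeight_castSucc]

lemma withHeight_sub (a b : Euc n) (h k : ℝ) :
    withHeight a h - withHeight b k = withHeight (a - b) (h - k) := by
  refine ext_withHeight (fun i => ?_) ?_ <;>
    simp [withHeight_last, withHeight_castSucc]

lemma smul_withHeight (r : ℝ) (a : Euc n) (h : ℝ) :
    r • withHeight a h = withHeight (r • a) (r * h) := by
  refine ext_withHeight (fun i => ?_) ?_ <;>
    simp [withHeight_last, withHeight_castSucc]

lemma norm_withHeight_sq (a : Euc n) (h : ℝ) : ‖withHeight a h‖ ^ 2 = ‖a‖ ^ 2 + h ^ 2 := by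
  rw [EuclideanSpace.norm_sq_eq, EuclideanSpace.norm_sq_eq, Fin.sum_univ_castSucc]
  simp [withHeight_last, withHeight_castSucc]

lemma upperBase_eq : upperBase n = withHeight 0 1 := by
  refine ext_withHeight (fun i => ?_) ?_
  · simp [upperBase, withHeight_castSucc]
  · simp [upperBase_last, withHeight_last]

lemma boundaryIncl_eq (x : Euc n) : boundaryIncl n x = withHeight x 0 := rfl

lemma continuous_withHeight : Continuous fun p : Euc n × ℝ => withHeight p.1 p.2 := by
  refine (PiLp.continuous_toLp 2 _).comp (continuous_pi fun i => ?_)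
  refine Fin.lastCases ?_ (fun i => ?_) i
  · simpa using continuous_snd
  · simp only [Fin.snoc_castSucc]
    fun_prop

lemma exists_eq_withHeight (z : Euc (n + 1)) : ∃ a : Euc n, ∃ h, z = withHeight a h :=
  ⟨WithLp.toLp 2 fun i => z i.castSucc, z (Fin.last n),
    ext_withHeight (by simp [withHeight_castSucc]) (by simp [withHeight_last])⟩

lemma withHeight_inj {a b : Euc n} {h k : ℝ} : withHeight a h = withHeight b k ↔ a = b ∧ h = k := by
  refine ⟨fun e => ⟨?_, ?_⟩, by rintro ⟨rfl, rfl⟩; rfl⟩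
  · ext i
    rw [← withHeight_castSucc a h, e, withHeight_castSucc]
  · rw [← withHeight_last a h, e, withHeight_last]

lemma boundaryIncl_ne (x : Euc n) : boundaryIncl n x ≠ -upperBase n := by
  intro h
  have := congrArg (fun z : Euc (n + 1) => z (Fin.last n)) h
  simp [boundaryIncl_eq, withHeight_last, upperBase_last] at this

lemma norm_cayley_boundaryIncl (x : Euc n) : ‖cayley n (boundaryIncl n x)‖ = 1 := by
  have h := one_sub_norm_cayley_sq (boundaryIncl_ne x)
  rw [boundaryIncl_eq, withHeight_last] at h
  have : ‖cayley n (boundaryIncl n x)‖ ^ 2 = 1 := by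
    rw [boundaryIncl_eq]; simp at h; linarith
  exact (pow_eq_one_iff_of_nonneg (norm_nonneg _) two_ne_zero).1 this

lemma cayley_injective : Function.Injective (cayley n) := fun x y h => by
  rw [← cayley_cayley x, h, cayley_cayley]

lemma tendsto_cayley_cobounded :
    Tendsto (cayley n) (Bornology.cobounded (Euc (n + 1))) (𝓝 (-upperBase n)) := by
  rw [tendsto_iff_dist_tendsto_zero]
  simp_rw [cayley, EuclideanGeometry.dist_inversion_center]
  refine Tendsto.const_div_atTop ?_ _
  exact tendsto_dist_right_atTop_iff _ |>.2 tendsto_id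

/-- The boundary values of `cayley` on `ℝ^n`. -/
def boundarySph (x : Euc n) : Sph (n + 1) :=
  ⟨cayley n (boundaryIncl n x), mem_sphere_zero_iff_norm.2 (norm_cayley_boundaryIncl x)⟩

/-- The centre of the inversion `cayley`. -/
def southPole (n : ℕ) : Sph (n + 1) :=
  ⟨-upperBase n, mem_sphere_zero_iff_norm.2 (by rw [norm_neg, norm_upperBase])⟩

/-- The boundary values of `cayley` on `ℝ^n ∪ {∞}`. -/
def boundarySphHat (x : OnePoint (Euc n)) : Sph (n + 1) := x.elim (southPole n) boundarySph

lemma boundarySphHat_infty : boundarySphHat (OnePoint.infty : OnePoint (Euc n)) = southPole n := rfl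

lemma continuous_boundaryIncl : Continuous (boundaryIncl n) :=
  continuous_withHeight.comp (continuous_id.prodMk continuous_const)

lemma continuousAt_cayley {x : Euc (n + 1)} (hx : x ≠ -upperBase n) : ContinuousAt (cayley n) x :=
  (hasFDerivAt_cayley hx).continuousAt

lemma continuous_boundarySph : Continuous (boundarySph (n := n)) := by
  refine Continuous.subtype_mk (continuous_iff_continuousAt.2 fun x => ?_) _
  exact (continuousAt_cayley (boundaryIncl_ne x)).comp continuous_boundaryIncl.continuousAt

lemma continuous_boundarySphHat : Continuous (boundarySphHat (n := n)) := by
  rw [OnePoint.continuous_iff]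
  refine ⟨?_, continuous_boundarySph⟩
  rw [coclosedCompact_eq_cocompact, ← cobounded_eq_cocompact, tendsto_subtype_rng]
  refine tendsto_cayley_cobounded.comp ?_
  rw [← tendsto_norm_atTop_iff_cobounded]
  refine tendsto_norm_cobounded_atTop.congr fun x => ?_
  rw [← sq_eq_sq₀ (norm_nonneg _) (norm_nonneg _), boundaryIncl_eq, norm_withHeight_sq]
  simp

lemma boundarySph_ne_southPole (x : Euc n) : boundarySph x ≠ southPole n := fun h =>
  cayley_ne (boundaryIncl_ne x) (congrArg Subtype.val h)

lemma boundarySph_injective : Function.Injective (boundarySph (n := n)) := fun _ _ h =>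
  (withHeight_inj.1 (cayley_injective (congrArg Subtype.val h))).1

lemma bijective_boundarySphHat : Function.Bijective (boundarySphHat (n := n)) := by
  constructor
  · intro x y h
    induction x using OnePoint.rec with
    | infty =>
      induction y using OnePoint.rec with
      | infty => rfl
      | coe y => exact absurd h.symm (boundarySph_ne_southPole y)
    | coe x =>
      induction y using OnePoint.rec with
      | infty => exact absurd h (boundarySph_ne_southPole x)
      | coe y => rw [boundarySph_injective h]
  · intro p
    by_cases hp : (p : Euc (n + 1)) = -upperBase n
    · exact ⟨OnePoint.infty, Subtype.ext hp.symm⟩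
    · obtain ⟨a, h, e⟩ := exists_eq_withHeight (cayley n p)
      -- The height of the image is a multiple of `1 - |p|²`, which is zero on the unit sphere.
      have h1 := cayley_last hp
      rw [norm_coe_sph, e, withHeight_last] at h1
      refine ⟨(a : OnePoint (Euc n)), Subtype.ext ?_⟩
      change cayley n (withHeight a 0) = p
      rw [show (0 : ℝ) = h by rw [h1]; simp, ← e, cayley_cayley]

/-- The boundary correspondence of the two models. -/
def boundaryHomeo (n : ℕ) : OnePoint (Euc n) ≃ₜ Sph (n + 1) :=
  Continuous.homeoOfEquivCompactToT2 (f := Equiv.ofBijective _ bijective_boundarySphHat)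
    continuous_boundarySphHat

instance borelSpaceOnePoint (n : ℕ) : BorelSpace (OnePoint (Euc n)) := ⟨rfl⟩

/-- The boundary correspondence on coordinate triples. -/
def boundaryTriples (n : ℕ) : UpperTriples n ≃ᵐ BallTriples n :=
  let e := (boundaryHomeo n).toMeasurableEquiv.prodCongr
    ((boundaryHomeo n).toMeasurableEquiv.prodCongr (MeasurableEquiv.refl ℝ))
  { toFun := fun p => ⟨e p.1, fun h => p.2 ((boundaryHomeo n).injective h)⟩
    invFun := fun p => ⟨e.symm p.1, fun h => p.2 ((boundaryHomeo n).symm.injective h)⟩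
    left_inv := fun p => Subtype.ext (e.symm_apply_apply p.1)
    right_inv := fun p => Subtype.ext (e.apply_symm_apply p.1)
    measurable_toFun := (e.measurable.comp measurable_subtype_coe).subtype_mk
    measurable_invFun := (e.symm.measurable.comp measurable_subtype_coe).subtype_mk }

lemma coe_boundaryTriples (p : UpperTriples n) : (boundaryTriples n p).1 =
    (boundarySphHat p.1.1, boundarySphHat p.1.2.1, p.1.2.2) := rfl

/-- At a finite point this is continuity of the involution on both sides. At `∞` it is the
correspondence between neighbourhoods of infinity and punctured neighbourhoods of the centre; `c`
avoids the centre, so its image does too. -/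
lemma tendsto_cayley_iff {c : ℝ → Euc (n + 1)} (hc : ∀ s, c s ≠ -upperBase n) {l : Filter ℝ}
    (x : OnePoint (Euc n)) :
    Tendsto (fun s => (c s : OnePoint (Euc (n + 1)))) l (𝓝 (boundaryInclHat n x)) ↔
      Tendsto (cayley n ∘ c) l (𝓝 (boundarySphHat x : Euc (n + 1))) := by
  have hcc : ∀ s, cayley n ((cayley n ∘ c) s) = c s := fun s => cayley_cayley _
  induction x using OnePoint.rec with
  | infty =>
    rw [boundarySphHat_infty]
    change Tendsto (OnePoint.some ∘ c) l (𝓝 OnePoint.infty) ↔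
      Tendsto (cayley n ∘ c) l (𝓝 (-upperBase n))
    rw [← tendsto_comap_iff, OnePoint.comap_coe_nhds_infty, coclosedCompact_eq_cocompact,
      ← cobounded_eq_cocompact]
    constructor
    · exact tendsto_cayley_cobounded.comp
    · intro h
      have h1 : Tendsto (cayley n ∘ c) l (𝓝[≠] (-upperBase n)) :=
        tendsto_nhdsWithin_iff.2 ⟨h, .of_forall fun s => cayley_ne (hc s)⟩
      exact ((EuclideanGeometry.tendsto_inversion_nhdsNE_center_cobounded
        (R := √2) (by positivity)).comp h1).congr hcc
  | coe x =>
    change Tendsto (OnePoint.some ∘ c) l (𝓝 ((boundaryIncl n x : Euc (n + 1)) : OnePoint _)) ↔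
      Tendsto (cayley n ∘ c) l (𝓝 (cayley n (boundaryIncl n x)))
    rw [← OnePoint.isOpenEmbedding_coe.isInducing.tendsto_nhds_iff]
    constructor
    · exact (continuousAt_cayley (boundaryIncl_ne x)).tendsto.comp
    · intro h
      have h1 := (continuousAt_cayley (cayley_ne (boundaryIncl_ne x))).tendsto.comp h
      rw [cayley_cayley] at h1
      exact h1.congr hcc

lemma isUpperCoord_iff (v : UpperUT n) (p : UpperTriples n) :
    IsUpperCoord n v p ↔ IsBallCoord n (cayleyUT n v) (boundaryTriples n p) := by
  constructor
  · rintro ⟨c, hc, hbot, htop⟩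
    have hne : ∀ s, c s ≠ -upperBase n := fun s => ne_of_mem_upper (hc.1.1 s)
    exact ⟨cayley n ∘ c, isGeodesicOf_cayley_upper hc, (tendsto_cayley_iff hne _).1 hbot,
      (tendsto_cayley_iff hne _).1 htop⟩
  · rintro ⟨c, hc, hbot, htop⟩
    have hne : ∀ s, (cayley n ∘ c) s ≠ -upperBase n := fun s =>
      cayley_ne (ne_of_mem_ball (hc.1.1 s))
    have hcc : cayley n ∘ cayley n ∘ c = c := funext fun s => cayley_cayley _
    have h := isGeodesicOf_cayley_ball hc
    rw [MeasurableEquiv.symm_apply_apply] at h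
    refine ⟨cayley n ∘ c, h, (tendsto_cayley_iff hne _).2 ?_, (tendsto_cayley_iff hne _).2 ?_⟩
    · rw [hcc]; exact hbot
    · rw [hcc]; exact htop

end Boundary

/-! ### Substitutions in Lebesgue integrals. -/

section ChangeOfVariables

lemma lintegral_Ioi_scale {k : ℝ} (hk : 0 < k) (F : ℝ → ENNReal) :
    ∫⁻ r in Set.Ioi 0, F r = ENNReal.ofReal k * ∫⁻ r in Set.Ioi 0, F (k * r) := by
  have himg : (fun r : ℝ => k * r) '' Set.Ioi 0 = Set.Ioi 0 := by
    ext x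
    simp only [Set.mem_image, Set.mem_Ioi]
    exact ⟨by rintro ⟨r, hr, rfl⟩; positivity, fun hx => ⟨k⁻¹ * x, by positivity, by field_simp⟩⟩
  have h := lintegral_image_eq_lintegral_abs_deriv_mul (s := Set.Ioi (0 : ℝ))
    (f := fun r => k * r) (f' := fun _ => k) measurableSet_Ioi
    (fun x _ => by simpa using ((hasDerivAt_id x).const_mul k).hasDerivWithinAt)
    (fun x _ y _ h => mul_left_cancel₀ hk.ne' h) F
  rw [himg, abs_of_pos hk, lintegral_const_mul' _ _ ENNReal.ofReal_ne_top] at h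
  exact h

lemma lintegral_Ioi_exp (F : ℝ → ENNReal) :
    ∫⁻ r in Set.Ioi 0, F r = ∫⁻ s, ENNReal.ofReal (Real.exp s) * F (Real.exp s) := by
  have h := lintegral_image_eq_lintegral_abs_deriv_mul (s := Set.univ)
    (f := Real.exp) (f' := Real.exp) MeasurableSet.univ
    (fun x _ => (Real.hasDerivAt_exp x).hasDerivWithinAt) Real.exp_injective.injOn F
  rw [Set.image_univ, Real.range_exp] at h
  simpa [abs_of_pos (Real.exp_pos _)] using h

/-- The substitution `h = d²/(2r) - r/2`, a decreasing bijection from `(0,∞)` to `ℝ`. -/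
lemma lintegral_eq_lintegral_Ioi_hyperbola {d : ℝ} (hd : 0 < d) (F : ℝ → ENNReal) :
    ∫⁻ h, F h = ∫⁻ r in Set.Ioi 0, ENNReal.ofReal ((d ^ 2 / r ^ 2 + 1) / 2) *
      F (d ^ 2 / (2 * r) - r / 2) := by
  have himg : (fun r : ℝ => d ^ 2 / (2 * r) - r / 2) '' Set.Ioi 0 = Set.univ := by
    -- The preimage is the positive root of `r² + 2hr - d² = 0`.
    refine Set.eq_univ_of_forall fun h => ⟨√(h ^ 2 + d ^ 2) - h, ?_, ?_⟩
    · have : |h| < √(h ^ 2 + d ^ 2) := by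
        rw [← Real.sqrt_sq_eq_abs]
        exact Real.sqrt_lt_sqrt (sq_nonneg h) (by nlinarith)
      exact sub_pos.2 ((le_abs_self h).trans_lt this)
    · have h1 : |h| < √(h ^ 2 + d ^ 2) := by
        rw [← Real.sqrt_sq_eq_abs]
        exact Real.sqrt_lt_sqrt (sq_nonneg h) (by nlinarith)
      have h2 : √(h ^ 2 + d ^ 2) - h ≠ 0 := (sub_pos.2 ((le_abs_self h).trans_lt h1)).ne'
      have h3 : √(h ^ 2 + d ^ 2) ^ 2 = h ^ 2 + d ^ 2 := Real.sq_sqrt (by positivity)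
      simp only
      field_simp
      linear_combination -h3
  have hinj : Set.InjOn (fun r : ℝ => d ^ 2 / (2 * r) - r / 2) (Set.Ioi 0) := by
    refine StrictAntiOn.injOn fun x hx y hy hxy => ?_
    have hx' : 0 < x := hx
    have : d ^ 2 / (2 * y) < d ^ 2 / (2 * x) := by gcongr
    linarith
  have h := lintegral_image_eq_lintegral_abs_deriv_mul (s := Set.Ioi (0 : ℝ))
    (f := fun r => d ^ 2 / (2 * r) - r / 2) (f' := fun r => -((d ^ 2 / r ^ 2 + 1) / 2))
    measurableSet_Ioi
    (fun x hx => by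
      have hx' : x ≠ 0 := ne_of_gt hx
      have h1 : HasDerivAt (fun r : ℝ => 2 * r) 2 x := by
        simpa using (hasDerivAt_id x).const_mul 2
      have h2 := (h1.fun_inv (by positivity)).const_mul (d ^ 2)
      have h3 := (h2.fun_sub ((hasDerivAt_id x).div_const 2)).hasDerivWithinAt (s := Set.Ioi 0)
      simp only [id, ← div_eq_mul_inv] at h3
      refine h3.congr_deriv ?_
      field_simp
      ring) hinj F
  rw [himg, Measure.restrict_univ] at h
  rw [h]
  refine lintegral_congr fun r => ?_
  rw [abs_neg, abs_of_nonneg (by positivity)]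

lemma lintegral_euc_scale {n : ℕ} {r : ℝ} (hr : r ≠ 0) {F : Euc n → ENNReal} (hF : Measurable F) :
    ∫⁻ y, F y = ENNReal.ofReal (|r| ^ n) * ∫⁻ x, F (r • x) := by
  have h := lintegral_map (μ := (volume : Measure (Euc n))) hF (measurable_const_smul r)
  rw [Measure.map_addHaar_smul _ hr, lintegral_smul_measure, finrank_euclideanSpace_fin] at h
  rw [← h, smul_eq_mul, ← mul_assoc, ← ENNReal.ofReal_mul (by positivity), abs_inv, abs_pow,
    mul_inv_cancel₀ (by positivity), ENNReal.ofReal_one, one_mul]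

end ChangeOfVariables

/-! ### Lebesgue measure as horizontal part times height. -/

section Height

variable {n : ℕ}

@[fun_prop]
lemma measurable_withHeight_comp {α : Type*} [MeasurableSpace α] {f : α → Euc n} {g : α → ℝ}
    (hf : Measurable f) (hg : Measurable g) : Measurable fun x => withHeight (f x) (g x) :=
  continuous_withHeight.measurable.comp (hf.prodMk hg)

lemma measurePreserving_withHeight (n : ℕ) :
    MeasurePreserving (fun p : Euc n × ℝ => withHeight p.1 p.2) (volume.prod volume) volume := by
  have h1 := ((volume_preserving_piFinSuccAbove (fun _ : Fin (n + 1) => ℝ) (Fin.last n)).symm)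
  have h2 := (PiLp.volume_preserving_toLp (Fin (n + 1))).comp h1
  have h3 := ((MeasurePreserving.id (volume : Measure ℝ)).prod (PiLp.volume_preserving_ofLp (Fin n)))
  have h4 := (h2.comp h3).comp
    (Measure.measurePreserving_swap (μ := (volume : Measure (Euc n))) (ν := (volume : Measure ℝ)))
  refine (congrArg (MeasurePreserving · (volume.prod volume) volume) (funext fun p => ?_)).mpr h4
  ext i
  refine Fin.lastCases ?_ (fun i => ?_) i
  · simp [withHeight_last]
  · simp [withHeight_castSucc]

lemma lintegral_withHeight {G : Euc (n + 1) → ENNReal} (hG : Measurable G) :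
    ∫⁻ z, G z = ∫⁻ y : Euc n, ∫⁻ h : ℝ, G (withHeight y h) := by
  rw [← (measurePreserving_withHeight n).lintegral_comp hG,
    lintegral_prod _ (by fun_prop)]

end Height

/-! ### The sphere measure in stereographic coordinates. -/

section Stereographic

open scoped Pointwise

variable {n : ℕ}

lemma norm_stereo (u : Euc n) :
    ‖withHeight ((2 / (1 + ‖u‖ ^ 2)) • u) ((‖u‖ ^ 2 - 1) / (1 + ‖u‖ ^ 2))‖ = 1 := by
  rw [← sq_eq_sq₀ (norm_nonneg _) zero_le_one, norm_withHeight_sq, norm_smul, mul_pow,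
    Real.norm_eq_abs, sq_abs]
  have : 1 + ‖u‖ ^ 2 ≠ 0 := by positivity
  field_simp
  ring

/-- The inverse of the stereographic projection from the last basis vector. -/
def stereo (u : Euc n) : Sph (n + 1) :=
  ⟨withHeight ((2 / (1 + ‖u‖ ^ 2)) • u) ((‖u‖ ^ 2 - 1) / (1 + ‖u‖ ^ 2)),
    mem_sphere_zero_iff_norm.2 (norm_stereo u)⟩

@[fun_prop]
lemma measurable_stereo : Measurable (stereo (n := n)) :=
  Measurable.subtype_mk (by fun_prop)

/-- Polar coordinates with stereographic angle, obtained from Fubini and substitutions with one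
variable frozen. At fixed horizontal part `y`, the height is replaced by `r = |z| - h`; at fixed
`r`, put `y = r x`, which makes `z` equal to `r(1+|x|²)/2` times `stereo x`; at fixed `x`, rescale
`r` to the true radius. The first step needs `y ≠ 0`, which holds almost everywhere because `n ≥ 1`.
-/
lemma lintegral_polar_stereo (hn : 1 ≤ n) {G : Euc (n + 1) → ENNReal} (hG : Measurable G) :
    ∫⁻ z, G z = ∫⁻ u : Euc n, ∫⁻ r in Set.Ioi (0 : ℝ),
      ENNReal.ofReal ((2 / (1 + ‖u‖ ^ 2)) ^ n * r ^ n) * G (r • (stereo u : Euc (n + 1))) := by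
  have : Nonempty (Fin n) := ⟨⟨0, hn⟩⟩
  have hae : ∀ᵐ y : Euc n, y ≠ 0 := by
    rw [ae_iff]; simp
  calc ∫⁻ z, G z = ∫⁻ y : Euc n, ∫⁻ h : ℝ, G (withHeight y h) := lintegral_withHeight hG
    _ = ∫⁻ y : Euc n, ∫⁻ r in Set.Ioi (0 : ℝ), ENNReal.ofReal ((‖y‖ ^ 2 / r ^ 2 + 1) / 2) *
          G (withHeight y (‖y‖ ^ 2 / (2 * r) - r / 2)) := by
        refine lintegral_congr_ae (hae.mono fun y hy => ?_)
        exact lintegral_eq_lintegral_Ioi_hyperbola (norm_pos_iff.2 hy) _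
    _ = ∫⁻ r in Set.Ioi (0 : ℝ), ∫⁻ y : Euc n, ENNReal.ofReal ((‖y‖ ^ 2 / r ^ 2 + 1) / 2) *
          G (withHeight y (‖y‖ ^ 2 / (2 * r) - r / 2)) :=
        lintegral_lintegral_swap (by unfold Function.uncurry; fun_prop)
    _ = ∫⁻ r in Set.Ioi (0 : ℝ), ∫⁻ x : Euc n, ENNReal.ofReal (r ^ n) *
          (ENNReal.ofReal ((‖x‖ ^ 2 + 1) / 2) *
            G (withHeight (r • x) (r * ((‖x‖ ^ 2 - 1) / 2)))) := by
        refine setLIntegral_congr_fun measurableSet_Ioi fun r hr => ?_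
        have hr' : 0 < r := hr
        rw [lintegral_euc_scale hr'.ne' (by fun_prop), abs_of_pos hr',
          lintegral_const_mul' _ _ ENNReal.ofReal_ne_top]
        congr 1
        refine lintegral_congr fun x => ?_
        rw [norm_smul, Real.norm_of_nonneg hr'.le]
        congr 4 <;> field_simp
    _ = ∫⁻ x : Euc n, ∫⁻ r in Set.Ioi (0 : ℝ), ENNReal.ofReal (r ^ n) *
          (ENNReal.ofReal ((‖x‖ ^ 2 + 1) / 2) *
            G (withHeight (r • x) (r * ((‖x‖ ^ 2 - 1) / 2)))) :=
        lintegral_lintegral_swap (by unfold Function.uncurry; fun_prop)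
    _ = _ := by
        refine lintegral_congr fun x => ?_
        have hx : 0 < 1 + ‖x‖ ^ 2 := by positivity
        rw [lintegral_Ioi_scale (k := 2 / (1 + ‖x‖ ^ 2)) (by positivity),
          ← lintegral_const_mul' _ _ ENNReal.ofReal_ne_top]
        refine setLIntegral_congr_fun measurableSet_Ioi fun r hr => ?_
        have hr' : 0 < r := hr
        rw [← mul_assoc, ← mul_assoc, ← ENNReal.ofReal_mul (by positivity),
          ← ENNReal.ofReal_mul (by positivity), stereo, smul_withHeight, ← mul_smul]
        congr 2
        · field_simp
          ring
        · congr 1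
          · congr 1; ring
          · field_simp

lemma mem_cone_iff {N : ℕ} {s : Set (Sph N)} {r : ℝ} (hr : 0 < r) (p : Sph N) :
    r • (p : Euc N) ∈ Set.Ioo (0 : ℝ) 1 • ((↑) '' s : Set (Euc N)) ↔ r < 1 ∧ p ∈ s := by
  rw [Set.mem_smul]
  constructor
  · rintro ⟨r', hr', _, ⟨p', hp', rfl⟩, h⟩
    have h1 := congrArg norm h
    rw [norm_smul, norm_smul, norm_coe_sph, norm_coe_sph, mul_one, mul_one,
      Real.norm_of_nonneg hr'.1.le, Real.norm_of_nonneg hr.le] at h1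
    subst h1
    have h2 : (p' : Euc N) = p := smul_right_injective _ hr.ne' h
    exact ⟨hr'.2, Subtype.ext h2 ▸ hp'⟩
  · rintro ⟨h1, h2⟩
    exact ⟨r, ⟨hr, h1⟩, p, ⟨p, h2, rfl⟩, rfl⟩

lemma measurableSet_cone {N : ℕ} {s : Set (Sph N)} (hs : MeasurableSet s) :
    MeasurableSet (Set.Ioo (0 : ℝ) 1 • ((↑) '' s : Set (Euc N))) := by
  have h1 : MeasurableSet ((↑) '' s : Set (Euc N)) :=
    (MeasurableEmbedding.subtype_coe isClosed_sphere.measurableSet).measurableSet_image.2 hs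
  have h2 : Set.Ioo (0 : ℝ) 1 • ((↑) '' s : Set (Euc N)) =
      {z : Euc N | 0 < ‖z‖ ∧ ‖z‖ < 1} ∩ (fun z => ‖z‖⁻¹ • z) ⁻¹' ((↑) '' s) := by
    ext z
    constructor
    · rintro ⟨r, hr, _, ⟨p, hp, rfl⟩, rfl⟩
      have hn : ‖r • (p : Euc N)‖ = r := by
        rw [norm_smul, norm_coe_sph, mul_one, Real.norm_of_nonneg hr.1.le]
      refine ⟨?_, ?_⟩
      · simp only [Set.mem_ofPred_eq, hn]; exact hr
      · refine ⟨p, hp, ?_⟩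
        simp only [hn]
        rw [inv_smul_smul₀ hr.1.ne']
    · rintro ⟨⟨h0, h1⟩, p, hp, e⟩
      refine ⟨‖z‖, ⟨h0, h1⟩, p, ⟨p, hp, rfl⟩, ?_⟩
      simp only at e ⊢
      rw [e, smul_inv_smul₀ h0.ne']
  rw [h2]
  refine MeasurableSet.inter ?_ (h1.preimage (by fun_prop))
  exact (measurableSet_lt measurable_const measurable_norm).inter
    (measurableSet_lt measurable_norm measurable_const)

lemma lintegral_pow_Ioo (n : ℕ) :
    ∫⁻ r in Set.Ioo (0 : ℝ) 1, ENNReal.ofReal (r ^ n) = ENNReal.ofReal (1 / (n + 1)) := by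
  rw [← ofReal_integral_eq_lintegral_ofReal]
  · rw [← integral_Ioc_eq_integral_Ioo, ← intervalIntegral.integral_of_le zero_le_one, integral_pow]
    simp
  · exact ((continuous_pow n).integrableOn_Icc).mono_set Set.Ioo_subset_Icc_self
  · exact (ae_restrict_mem measurableSet_Ioo).mono fun r hr => pow_nonneg hr.1.le n

/-- The measure of a set on the sphere is `n + 1` times the volume of the cone over it. In the
coordinates of `lintegral_polar_stereo` the radial integral over `(0,1)` contributes `1/(n+1)`. -/
theorem map_stereo (hn : 1 ≤ n) :
    ((volume : Measure (Euc n)).withDensity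
      fun u => ENNReal.ofReal ((2 / (1 + ‖u‖ ^ 2)) ^ n)).map stereo = sphVol (n + 1) := by
  ext s hs
  rw [Measure.map_apply measurable_stereo hs, withDensity_apply _ (measurable_stereo hs),
    sphVol, Measure.toSphere_apply' _ hs, ← lintegral_indicator_one (measurableSet_cone hs),
    lintegral_polar_stereo hn (measurable_one.indicator (measurableSet_cone hs)),
    ← lintegral_indicator (measurable_stereo hs), finrank_euclideanSpace_fin,
    ← lintegral_const_mul' _ _ (ENNReal.natCast_ne_top _)]
  refine lintegral_congr fun u => ?_
  by_cases hu : stereo u ∈ s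
  · have h1 : ∫⁻ r in Set.Ioi (0 : ℝ), ENNReal.ofReal ((2 / (1 + ‖u‖ ^ 2)) ^ n * r ^ n) *
        (Set.Ioo (0 : ℝ) 1 • ((↑) '' s : Set (Euc (n + 1)))).indicator 1
          (r • (stereo u : Euc (n + 1))) =
        ∫⁻ r in Set.Ioi (0 : ℝ), ENNReal.ofReal ((2 / (1 + ‖u‖ ^ 2)) ^ n) *
          (Set.Iio (1 : ℝ)).indicator (fun r => ENNReal.ofReal (r ^ n)) r := by
      refine setLIntegral_congr_fun measurableSet_Ioi fun r hr => ?_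
      rw [ENNReal.ofReal_mul (by positivity), mul_assoc]
      congr 1
      by_cases h1 : r < 1
      · rw [Set.indicator_of_mem ((mem_cone_iff hr _).2 ⟨h1, hu⟩),
          Set.indicator_of_mem (Set.mem_Iio.2 h1), Pi.one_apply, mul_one]
      · rw [Set.indicator_of_notMem fun h => h1 ((mem_cone_iff hr _).1 h).1,
          Set.indicator_of_notMem fun h => h1 (Set.mem_Iio.1 h), mul_zero]
    rw [h1, lintegral_const_mul' _ _ ENNReal.ofReal_ne_top, lintegral_indicator measurableSet_Iio,
      Measure.restrict_restrict measurableSet_Iio, Set.Iio_inter_Ioi, lintegral_pow_Ioo,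
      Set.indicator_of_mem (by exact hu), mul_left_comm]
    have h2 : ((n + 1 : ℕ) : ENNReal) = ENNReal.ofReal (n + 1) := by
      rw [← ENNReal.ofReal_natCast]; push_cast; rfl
    rw [h2, ← ENNReal.ofReal_mul (by positivity), mul_one_div_cancel (by positivity),
      ENNReal.ofReal_one, mul_one]
  · rw [Set.indicator_of_notMem (by exact hu)]
    symm
    rw [mul_eq_zero]
    right
    rw [lintegral_eq_zero_iff' ]
    · refine (ae_restrict_mem measurableSet_Ioi).mono fun r hr => ?_
      simp only
      rw [Set.indicator_of_notMem fun h => hu ((mem_cone_iff hr _).1 h).2, mul_zero]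
      rfl
    · have := measurable_one (α := ENNReal).indicator (measurableSet_cone hs)
      fun_prop

end Stereographic

/-! ### Rotation invariance of the sphere measure. -/

section SphereIsometry

open scoped Pointwise

variable {N : ℕ}

/-- A linear isometry acting on the unit sphere. -/
def sphIso (L : Euc N ≃ₗᵢ[ℝ] Euc N) (p : Sph N) : Sph N :=
  ⟨L p, mem_sphere_zero_iff_norm.2 (by rw [L.norm_map, norm_coe_sph])⟩

/-- A linear isometry maps the cone over a set to the cone over its image and preserves Lebesgue
measure. -/
lemma measurePreserving_sphIso (L : Euc N ≃ₗᵢ[ℝ] Euc N) :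
    MeasurePreserving (sphIso L) (sphVol N) (sphVol N) := by
  have hm : Measurable (sphIso L) :=
    (L.continuous.measurable.comp measurable_subtype_coe).subtype_mk
  refine ⟨hm, ?_⟩
  ext s hs
  rw [Measure.map_apply hm hs, sphVol, Measure.toSphere_apply' _ hs,
    Measure.toSphere_apply' _ (hm hs),
    ← L.measurePreserving.measure_preimage (measurableSet_cone hs).nullMeasurableSet]
  congr 2
  ext z
  constructor
  · rintro ⟨r, hr, _, ⟨p, hp, rfl⟩, rfl⟩
    exact ⟨r, hr, _, ⟨_, hp, rfl⟩, (L.map_smul r _).symm⟩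
  · rintro ⟨r, hr, _, ⟨p, hp, rfl⟩, h⟩
    have h1 : z = r • L.symm p := L.injective (by rw [← h]; simp)
    refine ⟨r, hr, _, ⟨sphIso L.symm p, ?_, rfl⟩, h1.symm⟩
    have : sphIso L (sphIso L.symm p) = p := Subtype.ext (L.apply_symm_apply _)
    rwa [Set.mem_preimage, this]

end SphereIsometry

/-! ### The action of the inversion on measures. -/

section CayleyMeasure

variable {n : ℕ}

lemma map_withDensity_comp {α β : Type*} [MeasurableSpace α] [MeasurableSpace β] (m : Measure α)
    {g : α → β} (hg : Measurable g) {f : β → ENNReal} (hf : Measurable f) :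
    (m.map g).withDensity f = (m.withDensity (f ∘ g)).map g := by
  ext s hs
  rw [withDensity_apply _ hs, Measure.map_apply hg hs, withDensity_apply _ (hg hs),
    setLIntegral_map hs hf hg]
  rfl

/-- `cayley` projects from the downward pole, `stereo` from the upward one; the reflection in the
horizontal hyperplane exchanges them. This transports `map_stereo` to the boundary correspondence.
-/
lemma boundarySph_eq (x : Euc n) :
    boundarySph x = sphIso (ℝ ∙ upperBase n)ᗮ.reflection (stereo x) := by
  refine Subtype.ext ?_
  change cayley n (boundaryIncl n x) = (ℝ ∙ upperBase n)ᗮ.reflection _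
  rw [Submodule.reflection_orthogonal_apply, Submodule.reflection_singleton_apply, cayley_eq,
    real_inner_comm, inner_upperBase, stereo, withHeight_last, boundaryIncl_eq, upperBase_eq,
    withHeight_add, norm_withHeight_sq]
  have h := norm_withHeight_sq (0 : Euc n) 1
  simp only [RCLike.ofReal_real_eq_id, id, h]
  rw [← Nat.cast_smul_eq_nsmul ℝ, smul_withHeight, smul_withHeight, smul_withHeight,
    withHeight_sub, withHeight_sub, ← neg_one_smul ℝ (withHeight _ _), smul_withHeight, withHeight_inj]
  have : 1 + ‖x‖ ^ 2 ≠ 0 := by positivity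
  constructor
  · simp [add_comm]
  · simp
    field_simp
    ring

theorem map_boundarySph (hn : 1 ≤ n) :
    ((volume : Measure (Euc n)).withDensity
      fun u => ENNReal.ofReal ((2 / (1 + ‖u‖ ^ 2)) ^ n)).map boundarySph = sphVol (n + 1) := by
  have h1 := measurePreserving_sphIso (ℝ ∙ upperBase n)ᗮ.reflection
  have h2 : boundarySph (n := n) = sphIso (ℝ ∙ upperBase n)ᗮ.reflection ∘ stereo :=
    funext boundarySph_eq
  rw [h2, ← Measure.map_map h1.measurable measurable_stereo, map_stereo hn, h1.map_eq]

lemma norm_boundarySph_sub_sq (x y : Euc n) :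
    ‖(boundarySph x : Euc (n + 1)) - boundarySph y‖ ^ 2 =
      2 / (1 + ‖x‖ ^ 2) * (2 / (1 + ‖y‖ ^ 2)) * ‖x - y‖ ^ 2 := by
  have h := EuclideanGeometry.dist_inversion_inversion (boundaryIncl_ne x) (boundaryIncl_ne y) (√2)
  rw [dist_eq_norm, dist_eq_norm, dist_eq_norm, dist_eq_norm, sub_neg_eq_add, sub_neg_eq_add,
    Real.sq_sqrt zero_le_two] at h
  change ‖cayley n (boundaryIncl n x) - cayley n (boundaryIncl n y)‖ ^ 2 = _
  rw [cayley, h, mul_pow, div_pow, mul_pow, boundaryIncl_eq, boundaryIncl_eq, upperBase_eq,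
    withHeight_add, withHeight_add, withHeight_sub, norm_withHeight_sq, norm_withHeight_sq,
    norm_withHeight_sq]
  simp only [add_zero, zero_add, one_pow, sub_zero]
  field_simp
  ring

/-- The measure `2^n dx dy dt / |x - y|^(2n)` on `ℝ^n × ℝ^n × ℝ`. -/
def endpointVol (n : ℕ) : Measure (Euc n × Euc n × ℝ) :=
  volume.withDensity fun p => ENNReal.ofReal (2 ^ n / ‖p.1 - p.2.1‖ ^ (2 * n))

/-- The boundary correspondence on finite coordinate triples. -/
def boundaryTriple (p : Euc n × Euc n × ℝ) : Sph (n + 1) × Sph (n + 1) × ℝ :=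
  (boundarySph p.1, boundarySph p.2.1, p.2.2)

lemma measurable_boundaryTriple : Measurable (boundaryTriple (n := n)) := by
  have := (continuous_boundarySph (n := n)).measurable
  unfold boundaryTriple
  fun_prop

/-- The sphere measure pulls back with density `(2/(1+|x|²))^n`, and by `norm_boundarySph_sub_sq`
the chordal distance to the power `2n` carries the product of the same factors for both endpoints.
They cancel. -/
theorem map_boundaryTriple (hn : 1 ≤ n) :
    (endpointVol n).map boundaryTriple =
      ((sphVol (n + 1)).prod ((sphVol (n + 1)).prod (volume : Measure ℝ))).withDensity
        fun p => ENNReal.ofReal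
          (2 ^ n / ‖(p.1 : Euc (n + 1)) - (p.2.1 : Euc (n + 1))‖ ^ (2 * n)) := by
  have hb := (continuous_boundarySph (n := n)).measurable
  set D : Euc n → ENNReal := fun u => ENNReal.ofReal ((2 / (1 + ‖u‖ ^ 2)) ^ n) with hD
  have hDm : Measurable D := by simp only [hD]; fun_prop
  have hs : SFinite ((volume : Measure (Euc n)).withDensity D) := inferInstance
  have h1 : (sphVol (n + 1)).prod ((sphVol (n + 1)).prod (volume : Measure ℝ)) =
      ((volume : Measure (Euc n × Euc n × ℝ)).withDensity fun p => D p.1 * D p.2.1).map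
        boundaryTriple := by
    have e1 : (volume.withDensity D).prod (volume : Measure ℝ) =
        ((volume : Measure (Euc n)).prod (volume : Measure ℝ)).withDensity fun p => D p.1 := by
      rw [← prod_withDensity_left hDm]
    have e2 : (volume.withDensity D).prod ((volume.withDensity D).prod (volume : Measure ℝ)) =
        (volume : Measure (Euc n × Euc n × ℝ)).withDensity fun p => D p.1 * D p.2.1 := by
      rw [e1, prod_withDensity hDm (by fun_prop)]
      rfl
    rw [← e2, ← map_boundarySph hn]
    conv_lhs => rw [← Measure.map_id (μ := (volume : Measure ℝ))]
    rw [Measure.map_prod_map _ _ hb measurable_id, Measure.map_prod_map _ _ hb (by fun_prop)]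
    rfl
  rw [h1, map_withDensity_comp _ measurable_boundaryTriple (by fun_prop),
    ← withDensity_mul _ (by fun_prop) (Measurable.comp (by fun_prop)
      measurable_boundaryTriple), endpointVol]
  congr 2
  ext p
  simp only [Pi.mul_apply, Function.comp_apply, boundaryTriple, hD]
  rw [← ENNReal.ofReal_mul (by positivity), ← ENNReal.ofReal_mul (by positivity), pow_mul,
    pow_mul, norm_boundarySph_sub_sq, mul_pow, mul_pow]
  congr 1
  have h2 : ((2 / (1 + ‖p.1‖ ^ 2)) ^ n * (2 / (1 + ‖p.2.1‖ ^ 2)) ^ n : ℝ) ≠ 0 := by positivity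
  rw [← mul_div_assoc, mul_div_mul_left _ _ h2]

/-- The derivative is a reflection times the scalar `2/|x+e|²`, so the Jacobian is the power `n + 1`
of this scalar. The same scalar relates the two conformal factors. -/
lemma measurePreserving_cayley (n : ℕ) :
    MeasurePreserving (cayley n) (confVol (upper n) (upperFactor n))
      (confVol (ball (0 : Euc (n + 1)) 1) (ballFactor n)) := by
  refine ⟨measurable_cayley, ?_⟩
  ext s hs
  have hU : MeasurableSet (cayley n ⁻¹' s ∩ upper n) :=
    (measurable_cayley hs).inter isOpen_upper.measurableSet
  have himg : cayley n '' (cayley n ⁻¹' s ∩ upper n) = s ∩ ball 0 1 := by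
    ext z
    simp only [Set.mem_image, Set.mem_inter_iff, Set.mem_preimage]
    constructor
    · rintro ⟨x, ⟨hx, hxu⟩, rfl⟩
      exact ⟨hx, cayley_mem_ball hxu⟩
    · rintro ⟨hz, hzb⟩
      refine ⟨cayley n z, ⟨?_, cayley_mem_upper hzb⟩, cayley_cayley z⟩
      rwa [cayley_cayley]
  rw [Measure.map_apply measurable_cayley hs, confVol, confVol, withDensity_apply _ hs,
    withDensity_apply _ (measurable_cayley hs), Measure.restrict_restrict hs,
    Measure.restrict_restrict (measurable_cayley hs), ← himg,
    lintegral_image_eq_lintegral_abs_det_fderiv_mul volume hU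
      (fun x hx => (hasFDerivAt_cayley (ne_of_mem_upper hx.2)).hasFDerivWithinAt)
      cayley_injective.injOn]
  refine setLIntegral_congr_fun hU fun x hx => ?_
  have hdet : |((2 / ‖x + upperBase n‖ ^ 2) •
      (cayleyRefl x : Euc (n + 1) →L[ℝ] Euc (n + 1))).det| =
      (2 / ‖x + upperBase n‖ ^ 2) ^ (n + 1) := by
    have h1 : ((2 / ‖x + upperBase n‖ ^ 2) •
        (cayleyRefl x : Euc (n + 1) →L[ℝ] Euc (n + 1)) : Euc (n + 1) →L[ℝ] Euc (n + 1)).toLinearMap =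
        (2 / ‖x + upperBase n‖ ^ 2) •
          (ℝ ∙ (x + upperBase n))ᗮ.reflection.toLinearMap := by
      ext w; rfl
    rw [ContinuousLinearMap.det, h1, LinearMap.det_smul, finrank_euclideanSpace_fin, Submodule.det_reflection, abs_mul,
      abs_pow, abs_pow, abs_neg, abs_one, one_pow, mul_one, abs_of_nonneg (by positivity)]
  have hb : 0 ≤ ballFactor n (cayley n x) := ballFactor_nonneg _ (cayley_mem_ball hx.2)
  rw [hdet, ← ENNReal.ofReal_mul (by positivity), ← mul_pow, mul_comm (2 / _),
    cayley_upper_conf hx.2]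

/-- The isometry `cayley` acting on pairs of a base point and a direction. -/
def cayleyDir (p : Euc (n + 1) × Sph (n + 1)) : Euc (n + 1) × Sph (n + 1) :=
  (cayley n p.1, sphIso (cayleyRefl p.1) p.2)

/-- A skew product: the base map preserves volume, and over each base point the directions move by a
linear isometry. -/
lemma measurePreserving_cayleyDir (n : ℕ) :
    MeasurePreserving (cayleyDir (n := n))
      ((confVol (upper n) (upperFactor n)).prod (sphVol (n + 1)))
      ((confVol (ball (0 : Euc (n + 1)) 1) (ballFactor n)).prod (sphVol (n + 1))) := by
  have : SFinite (confVol (upper n) (upperFactor n)) := by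
    unfold confVol; infer_instance
  have : SFinite (sphVol (n + 1)) := by unfold sphVol; infer_instance
  refine (measurePreserving_cayley n).skew_product (g := fun z => sphIso (cayleyRefl z)) ?_
    (.of_forall fun z => (measurePreserving_sphIso _).map_eq)
  have h : Measurable fun p : Euc (n + 1) × Sph (n + 1) => cayleyRefl p.1 (p.2 : Euc (n + 1)) := by
    simp only [cayleyRefl_apply]
    fun_prop
  have h2 : Measurable fun p : Euc (n + 1) × Sph (n + 1) => sphIso (cayleyRefl p.1) p.2 := by
    unfold sphIso
    exact h.subtype_mk
  exact h2

end CayleyMeasure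

/-! ### The volume formula in the half-space. -/

section UpperFormula

variable {n : ℕ}

/-- Change of variables on the pairs of a direction `u` and a height `h`, for geodesics with fixed
forward endpoint: `w` is the difference of the endpoints and `s` the arc length parameter. -/
lemma lintegral_height_direction (hn : 1 ≤ n) {f : Euc n → ℝ → ENNReal}
    (hf : Measurable (Function.uncurry f)) :
    ∫⁻ h in Set.Ioi (0 : ℝ), ∫⁻ u, f u h = ∫⁻ w : Euc n, ∫⁻ s : ℝ,
      ENNReal.ofReal (Real.exp s * (‖w‖ * ((‖w‖ * Real.exp s) ^ n)⁻¹ / (1 + Real.exp s ^ 2))) *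
        f (-(‖w‖ * Real.exp s)⁻¹ • w) (‖w‖ * Real.exp s / (1 + Real.exp s ^ 2)) := by
  have hf' : ∀ {α : Type} [MeasurableSpace α] {a : α → Euc n} {b : α → ℝ}, Measurable a →
      Measurable b → Measurable fun x => f (a x) (b x) := fun ha hb => hf.comp (ha.prodMk hb)
  have : Nonempty (Fin n) := ⟨⟨0, hn⟩⟩
  have hae : ∀ᵐ y : Euc n, y ≠ 0 := by
    rw [ae_iff]; simp
  -- With `b = -h u`, the horizontal offset from the forward endpoint to the base point, the
  -- substitutions are `u = -b/h`, `h = |b| k`, `b = w/(1+k²)` and `k = e^s`, each with the other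
  -- variable fixed.
  calc ∫⁻ h in Set.Ioi (0 : ℝ), ∫⁻ u, f u h
      = ∫⁻ h in Set.Ioi (0 : ℝ), ∫⁻ b : Euc n, ENNReal.ofReal ((h ^ n)⁻¹) * f (-h⁻¹ • b) h := by
        refine setLIntegral_congr_fun measurableSet_Ioi fun h hh => ?_
        have hh' : 0 < h := hh
        have hm : Measurable fun u => f u h := hf' measurable_id measurable_const
        rw [lintegral_euc_scale (r := -h⁻¹) (neg_ne_zero.2 (inv_ne_zero hh'.ne')) hm,
          lintegral_const_mul' _ _ ENNReal.ofReal_ne_top,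
          abs_neg, abs_inv, abs_of_pos hh', inv_pow]
    _ = ∫⁻ b : Euc n, ∫⁻ h in Set.Ioi (0 : ℝ), ENNReal.ofReal ((h ^ n)⁻¹) * f (-h⁻¹ • b) h :=
        lintegral_lintegral_swap (Measurable.aemeasurable
          (Measurable.mul (by fun_prop) (hf' (by fun_prop) (by fun_prop))))
    _ = ∫⁻ b : Euc n, ∫⁻ k in Set.Ioi (0 : ℝ), ENNReal.ofReal (‖b‖ * ((‖b‖ * k) ^ n)⁻¹) *
          f (-(‖b‖ * k)⁻¹ • b) (‖b‖ * k) := by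
        refine lintegral_congr_ae (hae.mono fun b hb => ?_)
        simp only
        rw [lintegral_Ioi_scale (norm_pos_iff.2 hb),
          ← lintegral_const_mul' _ _ ENNReal.ofReal_ne_top]
        refine lintegral_congr fun k => ?_
        rw [← mul_assoc, ← ENNReal.ofReal_mul (norm_nonneg b)]
    _ = ∫⁻ k in Set.Ioi (0 : ℝ), ∫⁻ b : Euc n, ENNReal.ofReal (‖b‖ * ((‖b‖ * k) ^ n)⁻¹) *
          f (-(‖b‖ * k)⁻¹ • b) (‖b‖ * k) :=
        lintegral_lintegral_swap (Measurable.aemeasurable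
          (Measurable.mul (by fun_prop) (hf' (by fun_prop) (by fun_prop))))
    _ = ∫⁻ k in Set.Ioi (0 : ℝ), ∫⁻ w : Euc n,
          ENNReal.ofReal (‖w‖ * ((‖w‖ * k) ^ n)⁻¹ / (1 + k ^ 2)) *
          f (-(‖w‖ * k)⁻¹ • w) (‖w‖ * k / (1 + k ^ 2)) := by
        refine setLIntegral_congr_fun measurableSet_Ioi fun k hk => ?_
        have hk' : 0 < 1 + k ^ 2 := by positivity
        have hm : Measurable fun b : Euc n => ENNReal.ofReal (‖b‖ * ((‖b‖ * k) ^ n)⁻¹) *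
            f (-(‖b‖ * k)⁻¹ • b) (‖b‖ * k) :=
          Measurable.mul (by fun_prop) (hf' (by fun_prop) (by fun_prop))
        rw [lintegral_euc_scale (r := (1 + k ^ 2)⁻¹) (inv_ne_zero hk'.ne') hm,
          ← lintegral_const_mul' _ _ ENNReal.ofReal_ne_top]
        refine lintegral_congr fun w => ?_
        rw [norm_smul, Real.norm_of_nonneg (inv_nonneg.2 hk'.le), abs_of_pos (inv_pos.2 hk'),
          ← mul_assoc, ← ENNReal.ofReal_mul (by positivity), ← mul_smul]
        congr 2
        · rw [mul_assoc _ ‖w‖ k, mul_pow, mul_inv]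
          field_simp
        · congr 1
          rw [mul_assoc _ ‖w‖ k, mul_inv, inv_inv]
          field_simp
        · field_simp
    _ = ∫⁻ w : Euc n, ∫⁻ k in Set.Ioi (0 : ℝ),
          ENNReal.ofReal (‖w‖ * ((‖w‖ * k) ^ n)⁻¹ / (1 + k ^ 2)) *
          f (-(‖w‖ * k)⁻¹ • w) (‖w‖ * k / (1 + k ^ 2)) :=
        lintegral_lintegral_swap (Measurable.aemeasurable
          (Measurable.mul (by fun_prop) (hf' (by fun_prop) (by fun_prop))))
    _ = _ := by
        refine lintegral_congr fun w => ?_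
        rw [lintegral_Ioi_exp]
        refine lintegral_congr fun s => ?_
        rw [← mul_assoc, ← ENNReal.ofReal_mul (Real.exp_pos s).le]

/-- The parameter, on the semicircle from `p` to `q` with its highest point at parameter `0`, of the
point closest to the base point. -/
def apexShift (p q : Euc n) : ℝ := Real.log ((1 + ‖p‖ ^ 2) / (1 + ‖q‖ ^ 2)) / 2

/-- The point of the semicircle from `q + w` to `q` at arc length `s` from its highest point. -/
def semicircle (w q : Euc n) (s : ℝ) : Euc (n + 1) :=
  withHeight (q + (1 + Real.exp s ^ 2)⁻¹ • w) (‖w‖ * Real.exp s / (1 + Real.exp s ^ 2))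

/-- The Euclidean direction of the semicircle from `q + w` to `q` at arc length `s` from its highest
point. -/
def semicircleDir (w : Euc n) (s : ℝ) : Sph (n + 1) := stereo (-(‖w‖ * Real.exp s)⁻¹ • w)

/-- The base point and the direction with given geodesic endpoint coordinates. -/
def upperParam (p : Euc n × Euc n × ℝ) : Euc (n + 1) × Sph (n + 1) :=
  (semicircle (p.1 - p.2.1) p.2.1 (p.2.2 + apexShift p.1 p.2.1),
    semicircleDir (p.1 - p.2.1) (p.2.2 + apexShift p.1 p.2.1))

lemma measurable_upperParam : Measurable (upperParam (n := n)) := by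
  unfold upperParam semicircle semicircleDir apexShift
  fun_prop

lemma lintegral_sphVol (hn : 1 ≤ n) {g : Sph (n + 1) → ENNReal} (hg : Measurable g) :
    ∫⁻ ω, g ω ∂sphVol (n + 1) =
      ∫⁻ u : Euc n, ENNReal.ofReal ((2 / (1 + ‖u‖ ^ 2)) ^ n) * g (stereo u) := by
  rw [← map_stereo hn, lintegral_map hg measurable_stereo,
    lintegral_withDensity_eq_lintegral_mul _ (by fun_prop) (by fun_prop)]
  rfl

lemma lintegral_confVol_upper {g : Euc (n + 1) → ENNReal} (hg : Measurable g) :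
    ∫⁻ z, g z ∂confVol (upper n) (upperFactor n) = ∫⁻ a : Euc n, ∫⁻ h in Set.Ioi (0 : ℝ),
      ENNReal.ofReal ((1 / h) ^ (n + 1)) * g (withHeight a h) := by
  have hl : Measurable fun z : Euc (n + 1) => ENNReal.ofReal (upperFactor n z ^ (n + 1)) := by
    unfold upperFactor; fun_prop
  rw [confVol, lintegral_withDensity_eq_lintegral_mul _ hl hg,
    ← lintegral_indicator isOpen_upper.measurableSet,
    lintegral_withHeight ((hl.mul hg).indicator isOpen_upper.measurableSet)]
  refine lintegral_congr fun a => ?_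
  rw [← lintegral_indicator measurableSet_Ioi]
  refine lintegral_congr fun h => ?_
  by_cases hh : h ∈ Set.Ioi (0 : ℝ)
  · have hm : withHeight a h ∈ upper n := by
      change (0 : ℝ) < withHeight a h (Fin.last n)
      rwa [withHeight_last]
    rw [Set.indicator_of_mem hm, Set.indicator_of_mem hh, Pi.mul_apply, upperFactor,
      withHeight_last]
  · have hm : withHeight a h ∉ upper n := fun hm => hh (by
      have : (0 : ℝ) < withHeight a h (Fin.last n) := hm
      rwa [withHeight_last] at this)
    rw [Set.indicator_of_notMem hm, Set.indicator_of_notMem hh]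

/-- The Jacobian of `lintegral_height_direction`, the density `h^{-(n+1)}` and the density of
`stereo` are multiplied together. For `w = 0` both sides are `0` by the convention for division by
zero; on the right this needs `n ≠ 0`. -/
lemma endpoint_density (hn : 1 ≤ n) (w : Euc n) (s : ℝ) :
    Real.exp s * (‖w‖ * ((‖w‖ * Real.exp s) ^ n)⁻¹ / (1 + Real.exp s ^ 2)) *
      ((1 / (‖w‖ * Real.exp s / (1 + Real.exp s ^ 2))) ^ (n + 1) *
        (2 / (1 + ‖-(‖w‖ * Real.exp s)⁻¹ • w‖ ^ 2)) ^ n) = 2 ^ n / ‖w‖ ^ (2 * n) := by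
  rcases eq_or_ne w 0 with rfl | hw
  · have : n ≠ 0 := by omega
    simp [this]
  have hw' : 0 < ‖w‖ := norm_pos_iff.2 hw
  have hk : 0 < Real.exp s := Real.exp_pos s
  have h1 : ‖-(‖w‖ * Real.exp s)⁻¹ • w‖ ^ 2 = (Real.exp s ^ 2)⁻¹ := by
    rw [norm_smul, norm_neg, norm_inv, Real.norm_of_nonneg (by positivity)]
    field_simp
  rw [h1]
  generalize Real.exp s = k at *
  generalize ‖w‖ = d at *
  have h2 : 2 / (1 + (k ^ 2)⁻¹) = 2 * k ^ 2 / (1 + k ^ 2) := by field_simp; ring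
  rw [h2]
  have : 0 < 1 + k ^ 2 := by positivity
  simp only [div_pow, mul_pow, one_pow, pow_succ, pow_mul]
  field_simp
  simp

lemma lintegral_endpointVol {g : Euc n × Euc n × ℝ → ENNReal} (hg : Measurable g) :
    ∫⁻ p, g p ∂endpointVol n =
      ∫⁻ p, ENNReal.ofReal (2 ^ n / ‖p.1 - p.2.1‖ ^ (2 * n)) * g p := by
  have hm : Measurable fun p : Euc n × Euc n × ℝ =>
      ENNReal.ofReal (2 ^ n / ‖p.1 - p.2.1‖ ^ (2 * n)) := by fun_prop
  rw [endpointVol, lintegral_withDensity_eq_lintegral_mul _ hm hg]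
  rfl

lemma lintegral_map_upperParam {g : Euc (n + 1) × Sph (n + 1) → ENNReal} (hg : Measurable g) :
    ∫⁻ p, g p ∂(endpointVol n).map upperParam =
      ∫⁻ p, ENNReal.ofReal (2 ^ n / ‖p.1 - p.2.1‖ ^ (2 * n)) * g (upperParam p) := by
  have h1 : ∫⁻ p, g p ∂(endpointVol n).map upperParam =
      ∫⁻ p, g (upperParam p) ∂endpointVol n := lintegral_map hg measurable_upperParam
  have h2 : Measurable fun p => g (upperParam p) := hg.comp (measurable_upperParam (n := n))
  rw [h1]
  exact lintegral_endpointVol h2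

lemma lintegral_prod_prod_swap {α β γ : Type*} [MeasurableSpace α] [MeasurableSpace β]
    [MeasurableSpace γ] (μ : Measure α) (ν : Measure β) (τ : Measure γ) [SFinite μ] [SFinite ν]
    [SFinite τ] {G : α × β × γ → ENNReal} (hG : Measurable G) :
    ∫⁻ p, G p ∂μ.prod (ν.prod τ) = ∫⁻ y, ∫⁻ x, ∫⁻ z, G (x, y, z) ∂τ ∂μ ∂ν := by
  have h1 : ∀ x, ∫⁻ p, G (x, p) ∂ν.prod τ = ∫⁻ y, ∫⁻ z, G (x, y, z) ∂τ ∂ν := fun x =>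
    lintegral_prod _ (hG.comp measurable_prodMk_left).aemeasurable
  rw [lintegral_prod _ hG.aemeasurable, lintegral_congr h1, lintegral_lintegral_swap]
  exact Measurable.aemeasurable (Measurable.lintegral_prod_right'
    (f := fun q : (α × β) × γ => G (q.1.1, q.1.2, q.2)) (hG.comp (by fun_prop)))

/-- Lebesgue measure is translation invariant, so the base point can be traded for the forward
endpoint at fixed `(u,h)`. After that only the substitution in `(u,h)` and a shift of arc length
remain. -/
theorem map_upperParam (hn : 1 ≤ n) :
    (endpointVol n).map upperParam =
      (confVol (upper n) (upperFactor n)).prod (sphVol (n + 1)) := by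
  have : SFinite (sphVol (n + 1)) := by unfold sphVol; infer_instance
  refine Measure.ext_of_lintegral _ fun g hg => ?_
  have hg' : ∀ {α : Type} [MeasurableSpace α] {a : α → Euc (n + 1)} {b : α → Sph (n + 1)},
      Measurable a → Measurable b → Measurable fun x => g (a x, b x) :=
    fun ha hb => hg.comp (ha.prodMk hb)
  symm
  calc ∫⁻ p, g p ∂(confVol (upper n) (upperFactor n)).prod (sphVol (n + 1))
      = ∫⁻ a : Euc n, ∫⁻ h in Set.Ioi (0 : ℝ), ∫⁻ u : Euc n,
          ENNReal.ofReal ((1 / h) ^ (n + 1)) * (ENNReal.ofReal ((2 / (1 + ‖u‖ ^ 2)) ^ n) *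
            g (withHeight a h, stereo u)) := by
        rw [lintegral_prod _ hg.aemeasurable, lintegral_confVol_upper hg.lintegral_prod_right']
        refine lintegral_congr fun a => lintegral_congr fun h => ?_
        have hm : Measurable fun ω => g (withHeight a h, ω) := hg' measurable_const measurable_id
        rw [lintegral_sphVol hn hm,
          lintegral_const_mul' _ _ ENNReal.ofReal_ne_top]
    _ = ∫⁻ h in Set.Ioi (0 : ℝ), ∫⁻ u : Euc n, ∫⁻ a : Euc n,
          ENNReal.ofReal ((1 / h) ^ (n + 1)) * (ENNReal.ofReal ((2 / (1 + ‖u‖ ^ 2)) ^ n) *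
            g (withHeight a h, stereo u)) := by
        rw [lintegral_lintegral_swap]
        · refine lintegral_congr fun h => ?_
          rw [lintegral_lintegral_swap]
          exact Measurable.aemeasurable (Measurable.mul (by fun_prop)
            (Measurable.mul (by fun_prop) (hg' (by fun_prop) (by fun_prop))))
        · refine Measurable.aemeasurable (Measurable.lintegral_prod_right' (f := fun x : (Euc n × ℝ) × Euc n =>
            ENNReal.ofReal ((1 / x.1.2) ^ (n + 1)) * (ENNReal.ofReal ((2 / (1 + ‖x.2‖ ^ 2)) ^ n) *
              g (withHeight x.1.1 x.1.2, stereo x.2))) ?_)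
          exact Measurable.mul (by fun_prop)
            (Measurable.mul (by fun_prop) (hg' (by fun_prop) (by fun_prop)))
    -- Translation from the horizontal part `a` to the forward endpoint `q = a + h u`.
    _ = ∫⁻ h in Set.Ioi (0 : ℝ), ∫⁻ u : Euc n, ∫⁻ q : Euc n,
          ENNReal.ofReal ((1 / h) ^ (n + 1)) * (ENNReal.ofReal ((2 / (1 + ‖u‖ ^ 2)) ^ n) *
            g (withHeight (q - h • u) h, stereo u)) := by
        refine lintegral_congr fun h => lintegral_congr fun u => ?_
        rw [← lintegral_sub_right_eq_self _ (h • u)]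
    _ = ∫⁻ w : Euc n, ∫⁻ s : ℝ, ∫⁻ q : Euc n, ENNReal.ofReal (2 ^ n / ‖w‖ ^ (2 * n)) *
          g (semicircle w q s, semicircleDir w s) := by
        rw [lintegral_height_direction hn (f := fun u h => ∫⁻ q : Euc n,
          ENNReal.ofReal ((1 / h) ^ (n + 1)) * (ENNReal.ofReal ((2 / (1 + ‖u‖ ^ 2)) ^ n) *
            g (withHeight (q - h • u) h, stereo u)))]
        · refine lintegral_congr fun w => lintegral_congr fun s => ?_
          rw [← lintegral_const_mul' _ _ ENNReal.ofReal_ne_top]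
          refine lintegral_congr fun q => ?_
          have e : ∀ A B C : ℝ, 0 ≤ A → 0 ≤ B → ENNReal.ofReal (A * (B * C)) =
              ENNReal.ofReal A * (ENNReal.ofReal B * ENNReal.ofReal C) := fun A B C hA hB => by
            rw [ENNReal.ofReal_mul hA, ENNReal.ofReal_mul hB]
          have hu : q - (‖w‖ * Real.exp s / (1 + Real.exp s ^ 2)) • -(‖w‖ * Real.exp s)⁻¹ • w =
              q + (1 + Real.exp s ^ 2)⁻¹ • w := by
            rcases eq_or_ne w 0 with rfl | hw
            · simp
            · have hw' : ‖w‖ ≠ 0 := norm_ne_zero_iff.2 hw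
              have hk : Real.exp s ≠ 0 := (Real.exp_pos s).ne'
              rw [sub_eq_add_neg, ← mul_smul, ← neg_smul]
              congr 2
              field_simp
          rw [← endpoint_density hn w s, e _ _ _ (by positivity) (by positivity), hu, semicircle,
            semicircleDir]
          simp only [mul_assoc]
        · refine Measurable.lintegral_prod_right' (f := fun x : (Euc n × ℝ) × Euc n =>
            ENNReal.ofReal ((1 / x.1.2) ^ (n + 1)) *
              (ENNReal.ofReal ((2 / (1 + ‖x.1.1‖ ^ 2)) ^ n) *
                g (withHeight (x.2 - x.1.2 • x.1.1) x.1.2, stereo x.1.1))) ?_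
          exact Measurable.mul (by fun_prop)
            (Measurable.mul (by fun_prop) (hg' (by fun_prop) (by fun_prop)))
    _ = ∫⁻ w : Euc n, ∫⁻ q : Euc n, ∫⁻ s : ℝ, ENNReal.ofReal (2 ^ n / ‖w‖ ^ (2 * n)) *
          g (semicircle w q s, semicircleDir w s) := by
        refine lintegral_congr fun w => ?_
        rw [lintegral_lintegral_swap]
        unfold semicircle semicircleDir
        exact Measurable.aemeasurable (Measurable.mul (by fun_prop)
          (hg' (by fun_prop) (by fun_prop)))
    _ = ∫⁻ q : Euc n, ∫⁻ w : Euc n, ∫⁻ s : ℝ, ENNReal.ofReal (2 ^ n / ‖w‖ ^ (2 * n)) *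
          g (semicircle w q s, semicircleDir w s) := by
        rw [lintegral_lintegral_swap]
        refine Measurable.aemeasurable (Measurable.lintegral_prod_right'
          (f := fun x : (Euc n × Euc n) × ℝ => ENNReal.ofReal (2 ^ n / ‖x.1.1‖ ^ (2 * n)) *
          g (semicircle x.1.1 x.1.2 x.2, semicircleDir x.1.1 x.2)) ?_)
        unfold semicircle semicircleDir
        exact Measurable.mul (by fun_prop) (hg' (by fun_prop) (by fun_prop))
    -- Two more translations: `w = p - q` at fixed `q`, and `s = t + apexShift p q` at fixed
    -- endpoints.
    _ = ∫⁻ q : Euc n, ∫⁻ p : Euc n, ∫⁻ t : ℝ, ENNReal.ofReal (2 ^ n / ‖p - q‖ ^ (2 * n)) *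
          g (upperParam (p, q, t)) := by
        refine lintegral_congr fun q => ?_
        rw [← lintegral_sub_right_eq_self _ q]
        refine lintegral_congr fun p => ?_
        rw [← lintegral_add_right_eq_self _ (apexShift p q)]
        rfl
    _ = ∫⁻ p : Euc n × Euc n × ℝ, ENNReal.ofReal (2 ^ n / ‖p.1 - p.2.1‖ ^ (2 * n)) *
          g (upperParam p) := by
        have hm : Measurable fun p : Euc n × Euc n × ℝ =>
            ENNReal.ofReal (2 ^ n / ‖p.1 - p.2.1‖ ^ (2 * n)) * g (upperParam p) :=
          Measurable.mul (by fun_prop) (hg.comp measurable_upperParam)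
        exact (lintegral_prod_prod_swap volume volume volume hm).symm
    _ = ∫⁻ p, g p ∂(endpointVol n).map upperParam :=
        (lintegral_map_upperParam hg).symm

end UpperFormula

/-! ### Semicircles as geodesics of the half-space. -/

section UpperGeodesics

variable {n : ℕ}

lemma cosh_confDist_upper {x z : Euc (n + 1)} (hx : x ∈ upper n) (hz : z ∈ upper n) :
    Real.cosh (confDist (upper n) (upperFactor n) x z) =
      1 + ‖x - z‖ ^ 2 / (2 * x (Fin.last n) * z (Fin.last n)) := by
  have hx' := ne_of_mem_upper hx
  have hz' := ne_of_mem_upper hz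
  have h1 : ‖x + upperBase n‖ ≠ 0 := (norm_add_upperBase_pos hx').ne'
  have h2 : ‖z + upperBase n‖ ≠ 0 := (norm_add_upperBase_pos hz').ne'
  have h3 : x (Fin.last n) ≠ 0 := ne_of_gt hx
  have h4 : z (Fin.last n) ≠ 0 := ne_of_gt hz
  have h := EuclideanGeometry.dist_inversion_inversion hx' hz' (√2)
  rw [dist_eq_norm, dist_eq_norm, dist_eq_norm, dist_eq_norm, sub_neg_eq_add, sub_neg_eq_add,
    Real.sq_sqrt zero_le_two] at h
  change ‖cayley n x - cayley n z‖ = _ at h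
  rw [← confDist_cayley_upper hx hz, cosh_confDist_ball (cayley_mem_ball hx) (cayley_mem_ball hz),
    ballCosh, one_sub_norm_cayley_sq hx', one_sub_norm_cayley_sq hz', h]
  field_simp
  ring

lemma semicircle_last (w q : Euc n) (s : ℝ) :
    semicircle w q s (Fin.last n) = ‖w‖ * Real.exp s / (1 + Real.exp s ^ 2) := withHeight_last _ _

lemma semicircle_mem {w : Euc n} (hw : w ≠ 0) (q : Euc n) (s : ℝ) : semicircle w q s ∈ upper n := by
  have : 0 < ‖w‖ := norm_pos_iff.2 hw
  change (0 : ℝ) < semicircle w q s (Fin.last n)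
  rw [semicircle_last]
  positivity

lemma norm_semicircle_sub_sq (w q : Euc n) (s r : ℝ) :
    ‖semicircle w q s - semicircle w q r‖ ^ 2 = ‖w‖ ^ 2 *
      (((1 + Real.exp s ^ 2)⁻¹ - (1 + Real.exp r ^ 2)⁻¹) ^ 2 +
        (Real.exp s / (1 + Real.exp s ^ 2) - Real.exp r / (1 + Real.exp r ^ 2)) ^ 2) := by
  rw [semicircle, semicircle, withHeight_sub, norm_withHeight_sq, add_sub_add_left_eq_sub,
    ← sub_smul, norm_smul, mul_pow, Real.norm_eq_abs, sq_abs]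
  ring

lemma isGeodesicLine_semicircle {w : Euc n} (hw : w ≠ 0) (q : Euc n) :
    IsGeodesicLine (upper n) (upperFactor n) (semicircle w q) := by
  have hw' : ‖w‖ ≠ 0 := norm_ne_zero_iff.2 hw
  refine ⟨semicircle_mem hw q, fun s r => ?_⟩
  have h := cosh_confDist_upper (semicircle_mem hw q s) (semicircle_mem hw q r)
  have h2 : Real.cosh (confDist (upper n) (upperFactor n) (semicircle w q s) (semicircle w q r)) =
      Real.cosh (s - r) := by
    rw [h, norm_semicircle_sub_sq, semicircle_last, semicircle_last, Real.cosh_eq, neg_sub,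
      Real.exp_sub, Real.exp_sub]
    have hk := Real.exp_pos s
    have hl := Real.exp_pos r
    generalize Real.exp s = k at *
    generalize Real.exp r = l at *
    have : 1 + k ^ 2 ≠ 0 := by positivity
    have : 1 + l ^ 2 ≠ 0 := by positivity
    field_simp
    ring
  rw [← abs_of_nonneg (confDist_nonneg upperFactor_nonneg (semicircle w q s) (semicircle w q r))]
  exact le_antisymm (Real.cosh_le_cosh.1 h2.le) (Real.cosh_le_cosh.1 h2.ge)

lemma cosh_confDist_base_semicircle {w : Euc n} (hw : w ≠ 0) (q : Euc n) (s : ℝ) :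
    Real.cosh (confDist (upper n) (upperFactor n) (upperBase n) (semicircle w q s)) =
      ((1 + ‖q‖ ^ 2) * Real.exp s + (1 + ‖q + w‖ ^ 2) * Real.exp (-s)) / (2 * ‖w‖) := by
  have hw' : ‖w‖ ≠ 0 := norm_ne_zero_iff.2 hw
  rw [cosh_confDist_upper upperBase_mem (semicircle_mem hw q s), upperBase_last, semicircle_last,
    semicircle, upperBase_eq, withHeight_sub, norm_withHeight_sq, zero_sub, norm_neg,
    norm_add_sq_real, norm_add_sq_real, norm_smul, inner_smul_right, mul_pow, Real.norm_eq_abs,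
    sq_abs, Real.exp_neg]
  have hk := Real.exp_pos s
  generalize Real.exp s = k at *
  have : 1 + k ^ 2 ≠ 0 := by positivity
  field_simp
  ring

/-- `cosh` of the distance is a positive multiple of `(1+|q|²) e^s + (1+|p|²) e^{-s}`, which is
least at `e^{2s} = (1+|p|²)/(1+|q|²)`. This is the origin of `apexShift`. -/
lemma confDist_base_semicircle_le {p q : Euc n} (hpq : p ≠ q) (s : ℝ) :
    confDist (upper n) (upperFactor n) (upperBase n) (semicircle (p - q) q (apexShift p q)) ≤
      confDist (upper n) (upperFactor n) (upperBase n) (semicircle (p - q) q s) := by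
  have hw := sub_ne_zero.2 hpq
  have hw' : 0 < 2 * ‖p - q‖ := by
    have := norm_pos_iff.2 hw
    positivity
  rw [← abs_of_nonneg (confDist_nonneg upperFactor_nonneg _ (semicircle _ _ (apexShift p q))),
    ← abs_of_nonneg (confDist_nonneg upperFactor_nonneg _ (semicircle _ _ s)),
    ← Real.cosh_le_cosh, cosh_confDist_base_semicircle hw, cosh_confDist_base_semicircle hw,
    add_sub_cancel, div_le_div_iff_of_pos_right hw']
  have hm : Real.exp (apexShift p q) ^ 2 = (1 + ‖p‖ ^ 2) / (1 + ‖q‖ ^ 2) := by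
    rw [← Real.exp_nat_mul, apexShift, Nat.cast_ofNat, mul_div_cancel₀ _ two_ne_zero,
      Real.exp_log (by positivity)]
  rw [eq_div_iff (by positivity)] at hm
  rw [Real.exp_neg, Real.exp_neg, ← hm]
  have hk := Real.exp_pos s
  have hl := Real.exp_pos (apexShift p q)
  generalize Real.exp s = k at *
  generalize Real.exp (apexShift p q) = l at *
  -- The excess over the minimum, written as a square.
  have hq : 0 ≤ (1 + ‖q‖ ^ 2) * (k - l) ^ 2 / k := by positivity
  have : (1 + ‖q‖ ^ 2) * k + l ^ 2 * (1 + ‖q‖ ^ 2) * k⁻¹ -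
      ((1 + ‖q‖ ^ 2) * l + l ^ 2 * (1 + ‖q‖ ^ 2) * l⁻¹) = (1 + ‖q‖ ^ 2) * (k - l) ^ 2 / k := by
    field_simp
    ring
  linarith

lemma hasDerivAt_withHeight {a : ℝ → Euc n} {h : ℝ → ℝ} {a' : Euc n} {h' t : ℝ}
    (ha : HasDerivAt a a' t) (hh : HasDerivAt h h' t) :
    HasDerivAt (fun s => withHeight (a s) (h s)) (withHeight a' h') t := by
  let L : (Euc n × ℝ) →ₗ[ℝ] Euc (n + 1) :=
    { toFun := fun p => withHeight p.1 p.2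
      map_add' := fun p q => (withHeight_add p.1 q.1 p.2 q.2).symm
      map_smul' := fun r p => (smul_withHeight r p.1 p.2).symm }
  exact (LinearMap.toContinuousLinearMap L).hasFDerivAt.comp_hasDerivAt t (ha.prodMk hh)

lemma hasDerivAt_semicircle {w : Euc n} (hw : w ≠ 0) (q : Euc n) (s : ℝ) :
    HasDerivAt (semicircle w q) ((upperFactor n (semicircle w q s))⁻¹ •
      (semicircleDir w s : Euc (n + 1))) s := by
  have hw' : 0 < ‖w‖ := norm_pos_iff.2 hw
  have hk := Real.exp_pos s
  have hd : 1 + Real.exp s ^ 2 ≠ 0 := by positivity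
  have h1 : HasDerivAt (fun s => 1 + Real.exp s ^ 2) (2 * Real.exp s ^ 2) s := by
    have := ((Real.hasDerivAt_exp s).pow 2).const_add 1
    refine this.congr_deriv ?_
    push_cast
    ring
  have h2 := ((h1.fun_inv hd).smul_const w).const_add q
  have h3 := (((Real.hasDerivAt_exp s).const_mul ‖w‖).fun_div h1 hd)
  refine (hasDerivAt_withHeight h2 h3).congr_deriv ?_
  have hu : ‖-(‖w‖ * Real.exp s)⁻¹ • w‖ ^ 2 = (Real.exp s ^ 2)⁻¹ := by
    rw [norm_smul, norm_neg, norm_inv, Real.norm_of_nonneg (by positivity)]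
    field_simp
  rw [upperFactor, semicircle_last, semicircleDir, stereo]
  simp only [hu, smul_withHeight, withHeight_inj, ← mul_smul]
  generalize Real.exp s = k at *
  generalize ‖w‖ = d at *
  have : k ^ 2 + 1 ≠ 0 := by positivity
  constructor
  · congr 1
    field_simp
    ring
  · field_simp
    ring

lemma tendsto_semicircle_atTop (w q : Euc n) :
    Tendsto (semicircle w q) atTop (𝓝 (boundaryIncl n q)) := by
  have h0 : Tendsto (fun s : ℝ => Real.exp (-s)) atTop (𝓝 0) :=
    Real.tendsto_exp_neg_atTop_nhds_zero
  have hc : Continuous fun r : ℝ =>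
      withHeight (q + (r ^ 2 / (r ^ 2 + 1)) • w) (‖w‖ * r / (r ^ 2 + 1)) := by
    have h1 : Continuous fun r : ℝ => r ^ 2 / (r ^ 2 + 1) :=
      Continuous.div (by fun_prop) (by fun_prop) fun r => by positivity
    have h2 : Continuous fun r : ℝ => ‖w‖ * r / (r ^ 2 + 1) :=
      Continuous.div (by fun_prop) (by fun_prop) fun r => by positivity
    exact continuous_withHeight.comp (Continuous.prodMk (by fun_prop) h2)
  have h := (hc.tendsto 0).comp h0
  have e : semicircle w q = (fun r : ℝ =>
      withHeight (q + (r ^ 2 / (r ^ 2 + 1)) • w) (‖w‖ * r / (r ^ 2 + 1))) ∘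
      fun s : ℝ => Real.exp (-s) := by
    ext1 s
    have hk := Real.exp_pos s
    simp only [Function.comp_apply, semicircle, withHeight_inj, Real.exp_neg]
    constructor
    · congr 2
      field_simp
    · field_simp
  rw [← e] at h
  simpa [boundaryIncl_eq] using h

lemma tendsto_semicircle_atBot (w q : Euc n) :
    Tendsto (semicircle w q) atBot (𝓝 (boundaryIncl n (q + w))) := by
  have hc : Continuous fun r : ℝ =>
      withHeight (q + (1 + r ^ 2)⁻¹ • w) (‖w‖ * r / (1 + r ^ 2)) := by
    have h1 : Continuous fun r : ℝ => (1 + r ^ 2)⁻¹ :=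
      Continuous.inv₀ (by fun_prop) fun r => by positivity
    have h2 : Continuous fun r : ℝ => ‖w‖ * r / (1 + r ^ 2) :=
      Continuous.div (by fun_prop) (by fun_prop) fun r => by positivity
    exact continuous_withHeight.comp (Continuous.prodMk (by fun_prop) h2)
  have h := (hc.tendsto 0).comp Real.tendsto_exp_atBot
  have e : boundaryIncl n (q + w) =
      withHeight (q + (1 + (0 : ℝ) ^ 2)⁻¹ • w) (‖w‖ * 0 / (1 + (0 : ℝ) ^ 2)) := by
    simp [boundaryIncl_eq]
  rw [e]
  exact h

/-- Identification of the base points and directions with tangent vectors. -/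
def scaleDir {N : ℕ} (lam : Euc N → ℝ) (p : Euc N × Sph N) : Euc N × Euc N :=
  (p.1, (lam p.1)⁻¹ • (p.2 : Euc N))

/-- The inclusion of the finite endpoint coordinates. -/
def coeTriple (p : Euc n × Euc n × ℝ) : OnePoint (Euc n) × OnePoint (Euc n) × ℝ :=
  (p.1, p.2.1, p.2.2)

/-- It suffices to exhibit one vector with the given coordinates: uniqueness comes from the ball
through `isUpperCoord_iff`. -/
theorem exists_isUpperCoord {p : Euc n × Euc n × ℝ} (hp : p.1 ≠ p.2.1) :
    ∃ (v : UpperUT n) (P : UpperTriples n), v.1 = scaleDir (upperFactor n) (upperParam p) ∧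
      P.1 = coeTriple p ∧ IsUpperCoord n v P := by
  obtain ⟨x, y, t⟩ := p
  have hw : x - y ≠ 0 := sub_ne_zero.2 hp
  have hg := isGeodesicLine_semicircle hw y
  set z := semicircle (x - y) y (t + apexShift x y)
  have hz : z ∈ upper n := hg.1 _
  have hl : 0 < upperFactor n z := one_div_pos.2 hz
  refine ⟨⟨scaleDir (upperFactor n) (upperParam (x, y, t)), hz, ?_⟩,
    ⟨coeTriple (x, y, t), fun h => hp (OnePoint.coe_injective h)⟩, rfl, rfl,
    fun s => semicircle (x - y) y (s + apexShift x y),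
    ⟨⟨fun s => hg.1 _, fun s r => ?_⟩, fun s => ?_, rfl, ?_⟩, ?_, ?_⟩
  · change upperFactor n z * ‖(upperFactor n z)⁻¹ • (_ : Euc (n + 1))‖ = 1
    rw [norm_smul, norm_coe_sph, mul_one, norm_inv, Real.norm_of_nonneg hl.le,
      mul_inv_cancel₀ hl.ne']
  · rw [hg.2, add_sub_add_right_eq_sub]
  · simp only [zero_add]
    exact confDist_base_semicircle_le hp _
  · exact (hasDerivAt_semicircle hw y (t + apexShift x y)).comp_add_const t (apexShift x y)
  · have h := (tendsto_semicircle_atBot (x - y) y).comp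
      (tendsto_atBot_add_const_right atBot (apexShift x y) tendsto_id)
    rw [add_sub_cancel] at h
    exact (OnePoint.continuous_coe.tendsto _).comp h
  · have h := (tendsto_semicircle_atTop (x - y) y).comp
      (tendsto_atTop_add_const_right atTop (apexShift x y) tendsto_id)
    exact (OnePoint.continuous_coe.tendsto _).comp h

end UpperGeodesics

/-! ### Comparison of the two image measures. -/

section Assembly

/-- An isomorphism between measurable subsets preserves the restrictions of two image measures if it
matches the images of almost every parameter. -/
lemma measurePreserving_comap_map {α β ι : Type*} [MeasurableSpace α] [MeasurableSpace β]
    [MeasurableSpace ι] {s : Set α} {t : Set β} (hs : MeasurableSet s) (ht : MeasurableSet t)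
    (Φ : s ≃ᵐ t) {ζ : Measure ι} {f : ι → α} {g : ι → β} (hf : Measurable f) (hg : Measurable g)
    (h : ∀ᵐ z ∂ζ, ∃ (a : s) (b : t), a.1 = f z ∧ b.1 = g z ∧ Φ a = b) :
    MeasurePreserving Φ ((ζ.map f).comap Subtype.val) ((ζ.map g).comap Subtype.val) := by
  refine ⟨Φ.measurable, ?_⟩
  ext A hA
  have hA' := Φ.measurable hA
  rw [Measure.map_apply Φ.measurable hA,
    comap_subtype_coe_apply hs _ _, comap_subtype_coe_apply ht _ _,
    Measure.map_apply hf (hs.subtype_image hA'), Measure.map_apply hg (ht.subtype_image hA)]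
  refine measure_congr (h.mono fun z hz => ?_)
  obtain ⟨a, b, ha, hb, hab⟩ := hz
  refine propext ?_
  change f z ∈ Subtype.val '' (Φ ⁻¹' A) ↔ g z ∈ Subtype.val '' A
  rw [← ha, ← hb, Subtype.val_injective.mem_set_image, Subtype.val_injective.mem_set_image,
    Set.mem_preimage, hab]

variable {n : ℕ}

/-- On the diagonal the density is `2^n/0 = 0`, since the exponent `2n` is positive. -/
lemma ae_endpointVol_ne (hn : 1 ≤ n) : ∀ᵐ p ∂endpointVol n, p.1 ≠ p.2.1 := by
  rw [endpointVol, ae_withDensity_iff (by fun_prop)]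
  refine .of_forall fun p hp h => hp ?_
  rw [h, sub_self, norm_zero, zero_pow (by omega), div_zero, ENNReal.ofReal_zero]

lemma measurable_coeTriple : Measurable (coeTriple (n := n)) := by
  have : Measurable fun x : Euc n => (x : OnePoint (Euc n)) :=
    OnePoint.continuous_coe.measurable
  unfold coeTriple
  fun_prop

lemma measurable_scaleDir {N : ℕ} {lam : Euc N → ℝ} (hlam : Measurable lam) :
    Measurable (scaleDir lam) := by
  unfold scaleDir
  fun_prop

lemma measurable_upperFactor : Measurable (upperFactor n) := by
  unfold upperFactor
  fun_prop

lemma measurable_ballFactor : Measurable (ballFactor n) := by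
  unfold ballFactor
  fun_prop

lemma measurableSet_unitTangent {N : ℕ} {D : Set (Euc N)} (hD : MeasurableSet D)
    {lam : Euc N → ℝ} (hlam : Measurable lam) :
    MeasurableSet {v : Euc N × Euc N | v.1 ∈ D ∧ lam v.1 * ‖v.2‖ = 1} :=
  (measurable_fst hD).inter
    (measurableSet_eq_fun (by fun_prop : Measurable fun v : Euc N × Euc N => lam v.1 * ‖v.2‖)
      measurable_const)

lemma measurableSet_upperTriples :
    MeasurableSet {p : OnePoint (Euc n) × OnePoint (Euc n) × ℝ | p.1 ≠ p.2.1} := by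
  have hb : Measurable (boundaryHomeo n) := (boundaryHomeo n).continuous.measurable
  have h : Measurable fun p : OnePoint (Euc n) × OnePoint (Euc n) × ℝ =>
      (boundaryHomeo n p.1, boundaryHomeo n p.2.1, p.2.2) := by fun_prop
  convert h measurableSet_ballTriples using 1
  ext p
  exact (boundaryHomeo n).injective.ne_iff.symm

lemma cayleyTangent_scaleDir {p : Euc (n + 1) × Sph (n + 1)} (hp : p.1 ∈ upper n) :
    cayleyTangent (scaleDir (upperFactor n) p) = scaleDir (ballFactor n) (cayleyDir p) := by
  refine Prod.ext rfl ?_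
  change (2 / ‖p.1 + upperBase n‖ ^ 2) • cayleyRefl p.1 ((upperFactor n p.1)⁻¹ • (p.2 : Euc (n + 1))) =
    (ballFactor n (cayley n p.1))⁻¹ • cayleyRefl p.1 (p.2 : Euc (n + 1))
  have h := norm_add_upperBase_pos (ne_of_mem_upper hp)
  rw [map_smul, ← mul_smul, ← cayley_upper_conf hp, mul_inv, mul_left_comm,
    mul_inv_cancel₀ (by positivity), mul_one]

lemma exists_isBallCoord {p : Euc n × Euc n × ℝ} (hp : p.1 ≠ p.2.1) :
    ∃ (v : BallUT n) (P : BallTriples n),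
      v.1 = scaleDir (ballFactor n) (cayleyDir (upperParam p)) ∧
      P.1 = boundaryTriple p ∧ IsBallCoord n v P := by
  obtain ⟨v, P, hv, hP, h⟩ := exists_isUpperCoord hp
  refine ⟨cayleyUT n v, boundaryTriples n P, ?_, ?_, (isUpperCoord_iff v P).1 h⟩
  · have hm : (upperParam p).1 ∈ upper n := by
      have := v.2.1
      rwa [hv] at this
    rw [coe_cayleyUT, hv, cayleyTangent_scaleDir hm]
  · rw [coe_boundaryTriples, hP]
    rfl

lemma measurePreserving_upperCoord (hn : 1 ≤ n) (Φ : UpperUT n ≃ᵐ UpperTriples n)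
    (hΦ : ∀ v p, IsUpperCoord n v p ↔ Φ v = p) :
    MeasurePreserving Φ (unitTangentVol (upper n) (upperFactor n)) (upperTripleVol n) := by
  have hs := measurable_scaleDir (measurable_upperFactor (n := n))
  have h := measurePreserving_comap_map
    (measurableSet_unitTangent isOpen_upper.measurableSet measurable_upperFactor)
    measurableSet_upperTriples Φ (ζ := endpointVol n) (hs.comp measurable_upperParam)
    measurable_coeTriple ((ae_endpointVol_ne hn).mono fun p hp => by
      obtain ⟨v, P, hv, hP, h⟩ := exists_isUpperCoord hp
      exact ⟨v, P, hv, hP, (hΦ v P).1 h⟩)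
  rwa [← Measure.map_map hs measurable_upperParam, map_upperParam hn] at h

/-- The parameter space is still that of the half-space: `cayleyDir ∘ upperParam` yields `dΩ` of the
ball, and `boundaryTriple` yields the measure on spherical triples. -/
lemma measurePreserving_ballCoord (hn : 1 ≤ n) (Φ : BallUT n ≃ᵐ BallTriples n)
    (hΦ : ∀ v p, IsBallCoord n v p ↔ Φ v = p) :
    MeasurePreserving Φ (unitTangentVol (ball (0 : Euc (n + 1)) 1) (ballFactor n))
      (ballTripleVol n) := by
  have hs := measurable_scaleDir (measurable_ballFactor (n := n))
  have hc := measurePreserving_cayleyDir n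
  have h := measurePreserving_comap_map
    (measurableSet_unitTangent isOpen_ball.measurableSet measurable_ballFactor)
    measurableSet_ballTriples Φ (ζ := endpointVol n)
    (hs.comp (hc.measurable.comp measurable_upperParam))
    measurable_boundaryTriple ((ae_endpointVol_ne hn).mono fun p hp => by
      obtain ⟨v, P, hv, hP, h⟩ := exists_isBallCoord hp
      exact ⟨v, P, hv, hP, (hΦ v P).1 h⟩)
  rwa [← Measure.map_map hs (hc.measurable.comp measurable_upperParam),
    ← Measure.map_map hc.measurable measurable_upperParam, map_upperParam hn, hc.map_eq,
    map_boundaryTriple hn] at h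

end Assembly

end HypUT
end

theorem theorem1p2 (n : ℕ) (hn : 1 ≤ n) :
    (∃ Φ : HypUT.UpperUT n ≃ᵐ HypUT.UpperTriples n,
      (∀ v p, HypUT.IsUpperCoord n v p ↔ Φ v = p) ∧
      MeasurePreserving Φ (HypUT.unitTangentVol (HypUT.upper n) (HypUT.upperFactor n))
        (HypUT.upperTripleVol n)) ∧
    (∃ Φ : HypUT.BallUT n ≃ᵐ HypUT.BallTriples n,
      (∀ v p, HypUT.IsBallCoord n v p ↔ Φ v = p) ∧
      MeasurePreserving Φ
        (HypUT.unitTangentVol (ball (0 : HypUT.Euc (n + 1)) 1) (HypUT.ballFactor n))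
        (HypUT.ballTripleVol n)) := by
  obtain ⟨Φ, hΦ⟩ := HypUT.exists_ballCoord n
  -- The half-space coordinates are those of the ball, conjugated by the inversion on tangent
  -- vectors and on the boundary.
  refine ⟨⟨(HypUT.cayleyUT n).trans (Φ.trans (HypUT.boundaryTriples n).symm), ?_, ?_⟩,
    Φ, hΦ, HypUT.measurePreserving_ballCoord hn Φ hΦ⟩
  all_goals
    have h : ∀ v p, HypUT.IsUpperCoord n v p ↔
        (HypUT.cayleyUT n).trans (Φ.trans (HypUT.boundaryTriples n).symm) v = p := fun v p => by
      rw [HypUT.isUpperCoord_iff, hΦ]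
      exact (MeasurableEquiv.symm_apply_eq _).symm
  · exact h
  · exact HypUT.measurePreserving_upperCoord hn _ h
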